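/- A real exponential $k$-sum ($k\ge 1$) is a function $f(x)=\sum_{a\in\mathcal A}c_ax^a$ with $\mathcal A\subset\mathbb R$ a set of exactly $k$ exponents and all $c_a\in\mathbb R\setminus\{0\}$; it is called a $k$-nomial if $\mathcal A\subset\mathbb Z$. Its degree is $d:=\max_{a,a'\in\mathcal A}(a-a')$ if $\mathcal A\subset\mathbb Z$ (so $d$ is the usual degree of a Laurent polynomial), and $d:=\max_{a,a'\in\mathcal A}(a-a')\,/\min\{1,\min_{a\ne a'}|a-a'|\}$ otherwise, where a monomial has degree $0$. The number of sign alternations of $f$ is the number of pairs $(a,a')\in\mathcal A^2$ with $a<a'$, $\mathcal A\cap(a,a')=\emptyset$ and $c_ac_{a'}<0$. Let $\log^+t:=\max\{0,\log t\}$ for $t>0$ and $\log^+0:=0$. Consider algorithms over $\mathbb R$ (programs for a random access machine that handles exact real numbers) that can use rational constants, $+,-,\times,\div$ and comparisons, at unit cost. The input is $k$, the list of the pairs $(c_a,a)$ in any order, and reals $R,\varepsilon>0$. To $\varepsilon$-approximate and count the roots of $f$ in $(0,R)$ means to output the number $n$ of these roots and reals $z_1,\dots,z_n$ such that $|z_i-\rho_i|\le\varepsilon$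 for all $i$, for some enumeration $\rho_1,\dots,\rho_n$ without repetition of the roots of $f$ in $(0,R)$. (1) There are a constant $C$ and an algorithm, which may in addition call an oracle for $(x,r)\mapsto x^r$ ($x>0$, $r\in\mathbb R$) at unit cost, that for all $k\ge1$, all $R,\varepsilon>0$ and every real exponential $k$-sum $f$ with at most one sign alternation, $\varepsilon$-approximates and counts all the roots of $f$ in $(0,R)$ in at most $$C\,k\,\bigl(1+\log^+d+\log^+\log^+(R/\varepsilon)\bigr)$$ operations (including oracle calls), where $d$ is the degree of $f$. (2) There are a constant $C$ and an algorithm without the oracle that does the same for every $k$-nomial $f$ with at most one sign alternation in at most $$C\,k\,(1+\log^+d)\bigl(1+\log^+d+\log^+\log^+(R/\varepsilon)\bigr)$$ operations. -/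

import Mathlib

open Real

/-! ### Real exponential sums -/

/-- A real exponential `k`-sum `f(x) = ∑ c_a x^a`, `a ∈ 𝒜`: its `k` distinct real exponents and
the corresponding nonzero real coefficients, listed in an arbitrary order. -/
structure ExpSum (k : ℕ) where
  coeff : Fin k → ℝ
  expo : Fin k → ℝ
  expo_injective : Function.Injective expo
  coeff_ne_zero : ∀ i, coeff i ≠ 0

namespace ExpSum

variable {k : ℕ} (f : ExpSum k)

/-- The value of the exponential sum at `x` (meaningful for `x > 0`). -/
noncomputable def eval (x : ℝ) : ℝ := ∑ i, f.coeff i * x ^ f.expo i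

/-- The set of roots in the open interval `(0, R)`. -/
def rootsIn (R : ℝ) : Set ℝ := {x | 0 < x ∧ x < R ∧ f.eval x = 0}

/-- All exponents are (possibly negative) integers: `f` is a `k`-nomial. -/
def IsNomial : Prop := ∀ i, ∃ n : ℤ, f.expo i = n

/-- The largest difference of two exponents. -/
noncomputable def spread : ℝ := ⨆ p : Fin k × Fin k, (f.expo p.1 - f.expo p.2)

/-- The smallest distance of two distinct exponents. -/
noncomputable def minGap : ℝ :=
  ⨅ p : {p : Fin k × Fin k // p.1 ≠ p.2}, |f.expo p.1.1 - f.expo p.1.2|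

open Classical in
/-- The degree: the largest difference of exponents if all exponents are integers, and otherwise
that number divided by `min {1, minGap}`. The degree of a monomial is `0`, its spread being `0`. -/
noncomputable def degree : ℝ :=
  if f.IsNomial then f.spread else f.spread / min 1 f.minGap

/-- The number of sign alternations: the number of pairs `(a, a')` of neighbouring exponents,
`a < a'`, whose coefficients have opposite signs. -/
noncomputable def signAlternations : ℕ :=
  Set.ncard {p : Fin k × Fin k | f.coeff p.1 * f.coeff p.2 < 0 ∧ f.expo p.1 < f.expo p.2 ∧
    ∀ l, ¬ (f.expo p.1 < f.expo l ∧ f.expo l < f.expo p.2)}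

end ExpSum

/-! ### A random access machine over the real numbers, with unit costs -/

namespace RealRAM

/-- A configuration of the memory: real registers, arrays of reals (the array number comes
first), and index registers holding natural numbers. -/
structure State where
  reg : ℕ → ℝ
  arr : ℕ → ℕ → ℝ
  idx : ℕ → ℕ

/-- Elementary instructions. The first argument is the target. There is no rounding, and no
passage between reals and index registers. -/
inductive Instr where
  | const (r : ℕ) (q : ℚ)
  | copy (r s : ℕ)
  | add (r s t : ℕ)
  | sub (r s t : ℕ)
  | mul (r s t : ℕ)
  | div (r s t : ℕ)
  /-- oracle call: register `r` receives (register `s`) to the power (register `t`) -/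
  | pow (r s t : ℕ)
  /-- register `r` receives the entry of array `A` whose position is in index register `i` -/
  | load (r A i : ℕ)
  /-- the entry of array `A` whose position is in index register `i` receives register `r` -/
  | store (A i r : ℕ)
  | iconst (i n : ℕ)
  | icopy (i j : ℕ)
  | isucc (i : ℕ)
  | ipred (i : ℕ)

/-- Tests, comparing two real registers or two index registers. -/
inductive Test where
  | lt (r s : ℕ)
  | le (r s : ℕ)
  | ilt (i j : ℕ)
  | ile (i j : ℕ)

/-- Programs. -/
inductive Program where
  | skip
  | instr (I : Instr)
  | seq (P Q : Program)
  | ite (b : Test) (P Q : Program)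
  | while (b : Test) (P : Program)

/-- An instruction is defined unless it divides by zero or asks the oracle for a power of a
non-positive number; an undefined instruction blocks the machine. -/
def Instr.Defined (σ : State) : Instr → Prop
  | .div _ _ t => σ.reg t ≠ 0
  | .pow _ s _ => 0 < σ.reg s
  | _ => True

/-- The effect of an instruction. -/
noncomputable def Instr.run (σ : State) : Instr → State
  | .const r q => { σ with reg := Function.update σ.reg r (q : ℝ) }
  | .copy r s => { σ with reg := Function.update σ.reg r (σ.reg s) }
  | .add r s t => { σ with reg := Function.update σ.reg r (σ.reg s + σ.reg t) }
  | .sub r s t => { σ with reg := Function.update σ.reg r (σ.reg s - σ.reg t) }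
  | .mul r s t => { σ with reg := Function.update σ.reg r (σ.reg s * σ.reg t) }
  | .div r s t => { σ with reg := Function.update σ.reg r (σ.reg s / σ.reg t) }
  | .pow r s t => { σ with reg := Function.update σ.reg r (σ.reg s ^ σ.reg t) }
  | .load r A i => { σ with reg := Function.update σ.reg r (σ.arr A (σ.idx i)) }
  | .store A i r =>
      { σ with arr := Function.update σ.arr A (Function.update (σ.arr A) (σ.idx i) (σ.reg r)) }
  | .iconst i n => { σ with idx := Function.update σ.idx i n }
  | .icopy i j => { σ with idx := Function.update σ.idx i (σ.idx j) }
  | .isucc i => { σ with idx := Function.update σ.idx i (σ.idx i + 1) }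
  | .ipred i => { σ with idx := Function.update σ.idx i (σ.idx i - 1) }

/-- The truth of a test. -/
def Test.Holds (σ : State) : Test → Prop
  | .lt r s => σ.reg r < σ.reg s
  | .le r s => σ.reg r ≤ σ.reg s
  | .ilt i j => σ.idx i < σ.idx j
  | .ile i j => σ.idx i ≤ σ.idx j

/-- `Exec P σ t σ'`: started in `σ`, the program `P` halts in `σ'` after exactly `t` steps. Every
instruction (arithmetic operation, oracle call, data transfer, index operation) and every
evaluation of a test is one step. -/
inductive Exec : Program → State → ℕ → State → Prop where
  | skip (σ : State) : Exec .skip σ 0 σ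
  | instr {I : Instr} {σ : State} (h : I.Defined σ) : Exec (.instr I) σ 1 (I.run σ)
  | seq {P Q : Program} {σ σ' σ'' : State} {t t' : ℕ} (h : Exec P σ t σ')
      (h' : Exec Q σ' t' σ'') : Exec (.seq P Q) σ (t + t') σ''
  | iteTrue {b : Test} {P Q : Program} {σ σ' : State} {t : ℕ} (hb : b.Holds σ)
      (h : Exec P σ t σ') : Exec (.ite b P Q) σ (t + 1) σ'
  | iteFalse {b : Test} {P Q : Program} {σ σ' : State} {t : ℕ} (hb : ¬ b.Holds σ)
      (h : Exec Q σ t σ') : Exec (.ite b P Q) σ (t + 1) σ'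
  | whileFalse {b : Test} {P : Program} {σ : State} (hb : ¬ b.Holds σ) :
      Exec (.while b P) σ 1 σ
  | whileTrue {b : Test} {P : Program} {σ σ' σ'' : State} {t t' : ℕ} (hb : b.Holds σ)
      (h : Exec P σ t σ') (h' : Exec (.while b P) σ' t' σ'') :
      Exec (.while b P) σ (t + t' + 1) σ''

/-- The program contains no oracle call. -/
def Program.OracleFree : Program → Prop
  | .skip => True
  | .instr (.pow _ _ _) => False
  | .instr _ => True
  | .seq P Q => P.OracleFree ∧ Q.OracleFree
  | .ite _ P Q => P.OracleFree ∧ Q.OracleFree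
  | .while _ P => P.OracleFree

/-- The initial memory on input `(f, R, ε)`: index register `0` holds `k`, real registers `0` and
`1` hold `R` and `ε`, the arrays `0` and `1` hold the coefficients and the exponents, and
everything else is zero. -/
noncomputable def input {k : ℕ} (f : ExpSum k) (R ε : ℝ) : State where
  reg := fun r => if r = 0 then R else if r = 1 then ε else 0
  arr := fun A i =>
    if h : i < k then (if A = 0 then f.coeff ⟨i, h⟩ else if A = 1 then f.expo ⟨i, h⟩ else 0) else 0
  idx := fun i => if i = 0 then k else 0

/-- The final memory solves the problem `(f, R, ε)`: index register `0` holds the number of roots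
of `f` in `(0, R)`, and array `0` starts with one `ε`-approximation for each of these roots. -/
def Solves {k : ℕ} (f : ExpSum k) (R ε : ℝ) (σ : State) : Prop :=
  ∃ ρ : Fin (σ.idx 0) → ℝ, Function.Injective ρ ∧ Set.range ρ = f.rootsIn R ∧
    ∀ i : Fin (σ.idx 0), |σ.arr 0 i - ρ i| ≤ ε

/-- On input `(f, R, ε)` the program halts with a solution within at most `T` steps. -/
def SolvesWithin (P : Program) {k : ℕ} (f : ExpSum k) (R ε T : ℝ) : Prop :=
  ∃ (t : ℕ) (σ : State), Exec P (input f R ε) t σ ∧ Solves f R ε σ ∧ (t : ℝ) ≤ T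

end RealRAM

/-!
An exponential sum `f` with one sign alternation has its coefficients of one sign below and those
of the other sign above a separating exponent `s`. Hence all coefficients `c * (a - s)` of
`x * g' x`, where `g x = x ^ (-s) * f x`, have the same sign: `g` is strictly monotone, and it has
at most one root `ρ`. Let `m` be the lowest exponent. The algorithm only uses the two sums
`∑ c * x ^ (a - m)` and `∑ c * (a - s) * x ^ (a - m)`, whose quotient is `g x / (x * g' x)`. Whatever
the orientation of `f`, the product of the two sums is positive exactly if `ρ < x`
(`ExpSum.Separates.pos_iff`), and Newton's method for `g` is `x ↦ x * (1 - quotient)`. The exponent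
`s` is the larger one of the lowest exponent of a positive and the lowest exponent of a negative
coefficient, and `m` is the smaller one. If `f` has no sign alternation, the product is never
positive, so that the answer "no root" comes out without a test for alternations
(`ExpSum.Scanned.separates_or`).

A sign test at `R` decides whether there is a root in `(0, R)`. If there is one and it is not below
`ε`, the numbers `2 ^ 2 ^ i` are tabulated until `ε * 2 ^ 2 ^ i ≥ R`; going through the table
backwards gives `y` with `y ≤ ρ < 2 * y` after `O(log log (R / ε))` sign tests and without square
roots. With `K - 1` the difference of the extreme exponents, `O(log K)` bisections make the relative
error smaller than `1 / (16 * K)`. There Newton's method converges quadratically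
(`ExpSum.Oriented.newton`, `RealRAM.newton_step`): since all terms of `x * g' x` have the same sign,
the Taylor estimates of the single powers, whose errors are proportional to `|a - s|`, add up to an
error proportional to `g'`. So `O(log log (R / ε))` Newton steps suffice. The gaps between the
exponents play no role: the difference of the extreme exponents is at most the degree
(`ExpSum.sub_le_degree`).

One evaluation takes `O(k)` steps with the oracle, and `O(k * (1 + log d))` steps with binary
powering, which applies to integer exponents because `a - m` is a natural number
(`RealRAM.computesPow_binaryPow`). The programs are verified by means of a total correctness
judgement `RealRAM.Runs` that bounds the number of steps.
-/

namespace RealRAM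

/-! ### Total correctness with a time bound -/

/-- Started in `σ`, the program `P` halts after at most `T` steps, in a state satisfying `Q`. -/
def Runs (P : Program) (σ : State) (T : ℕ) (Q : State → Prop) : Prop :=
  ∃ (t : ℕ) (σ' : State), Exec P σ t σ' ∧ t ≤ T ∧ Q σ'

theorem Runs.mono {P : Program} {σ : State} {T T' : ℕ} {Q Q' : State → Prop}
    (h : Runs P σ T Q) (hT : T ≤ T') (hQ : ∀ σ', Q σ' → Q' σ') : Runs P σ T' Q' := by
  obtain ⟨t, σ', h1, h2, h3⟩ := h
  exact ⟨t, σ', h1, h2.trans hT, hQ _ h3⟩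

theorem runs_skip {σ : State} {Q : State → Prop} (h : Q σ) : Runs .skip σ 0 Q :=
  ⟨0, σ, .skip σ, le_rfl, h⟩

theorem runs_instr {I : Instr} {σ : State} {Q : State → Prop} (hd : I.Defined σ)
    (h : Q (I.run σ)) : Runs (.instr I) σ 1 Q :=
  ⟨1, _, .instr hd, le_rfl, h⟩

theorem Runs.seq {P P' : Program} {σ : State} {T T' : ℕ} {M Q : State → Prop}
    (h : Runs P σ T M) (h' : ∀ σ', M σ' → Runs P' σ' T' Q) : Runs (.seq P P') σ (T + T') Q := by
  obtain ⟨t, σ', h1, h2, h3⟩ := h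
  obtain ⟨t', σ'', h1', h2', h3'⟩ := h' _ h3
  exact ⟨t + t', σ'', .seq h1 h1', add_le_add h2 h2', h3'⟩

theorem runs_ite {b : Test} {P P' : Program} {σ : State} {T : ℕ} {Q : State → Prop}
    (h : b.Holds σ → Runs P σ T Q) (h' : ¬ b.Holds σ → Runs P' σ T Q) :
    Runs (.ite b P P') σ (T + 1) Q := by
  by_cases hb : b.Holds σ
  · obtain ⟨t, σ', h1, h2, h3⟩ := h hb
    exact ⟨t + 1, σ', .iteTrue hb h1, by omega, h3⟩
  · obtain ⟨t, σ', h1, h2, h3⟩ := h' hb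
    exact ⟨t + 1, σ', .iteFalse hb h1, by omega, h3⟩

/-- The rule for loops. The invariant `I n` holds while at most `n` more iterations are to come. -/
theorem runs_while {b : Test} {P : Program} {T : ℕ} {Q : State → Prop} (I : ℕ → State → Prop)
    (step : ∀ n σ, I n σ → b.Holds σ → ∃ n', n = n' + 1 ∧ Runs P σ T (I n'))
    (leave : ∀ n σ, I n σ → ¬ b.Holds σ → Q σ) (n : ℕ) :
    ∀ σ, I n σ → Runs (.while b P) σ (n * (T + 1) + 1) Q := by
  induction n with
  | zero =>
    intro σ h
    by_cases hb : b.Holds σ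
    · obtain ⟨n', hn', -⟩ := step 0 σ h hb
      omega
    · exact ⟨1, σ, .whileFalse hb, by omega, leave _ _ h hb⟩
  | succ n ih =>
    intro σ h
    by_cases hb : b.Holds σ
    · obtain ⟨n', hn', t, σ', h1, h2, h3⟩ := step _ σ h hb
      obtain rfl : n = n' := by omega
      obtain ⟨t', σ'', h1', h2', h3'⟩ := ih σ' h3
      refine ⟨t + t' + 1, σ'', .whileTrue hb h1 h1', ?_, h3'⟩
      rw [add_mul]
      omega
    · exact ⟨1, σ, .whileFalse hb, by omega, leave _ _ h hb⟩

/-- The straight-line program made of a list of instructions. -/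
def block : List Instr → Program
  | [] => .skip
  | I :: l => .seq (.instr I) (block l)

/-- All instructions of the list are defined when they are executed one after the other. -/
def BlockDefined : List Instr → State → Prop
  | [], _ => True
  | I :: l, σ => I.Defined σ ∧ BlockDefined l (I.run σ)

theorem runs_block (l : List Instr) {σ : State} {Q : State → Prop} (hd : BlockDefined l σ)
    (h : Q (l.foldl (fun σ I => I.run σ) σ)) : Runs (block l) σ l.length Q := by
  induction l generalizing σ with
  | nil => exact runs_skip h
  | cons I l ih =>
    rw [List.length_cons, add_comm]
    exact (runs_instr (Q := fun σ' => σ' = I.run σ) hd.1 rfl).seq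
      (by rintro _ rfl; exact ih hd.2 h)

/-! ### Powers -/

/-- `P` is a subprogram that raises the content of register `5` to the power in register `13`
within `T` steps, whenever that exponent satisfies `A`. The result goes to register `14`; the
registers up to `13`, the arrays and the index registers are left as they were. -/
def ComputesPow (P : Program) (A : ℝ → Prop) (T : ℕ) : Prop :=
  ∀ σ : State, 0 < σ.reg 5 → A (σ.reg 13) → Runs P σ T fun σ' =>
    σ'.reg 14 = σ.reg 5 ^ σ.reg 13 ∧ (∀ r ≤ 13, σ'.reg r = σ.reg r) ∧
      σ'.arr = σ.arr ∧ σ'.idx = σ.idx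

theorem computesPow_oracle : ComputesPow (.instr (.pow 14 5 13)) (fun _ => True) 1 := by
  intro σ hx _
  refine runs_instr hx ⟨by simp [Instr.run], ?_, rfl, rfl⟩
  intro r hr
  simp [Instr.run, Function.update, show r ≠ 14 by omega]

/-- Binary powering, from the leading digit of the exponent on. Registers: `14` the power, `15` the
current power of two, `16` the part of the exponent that is still to be treated. -/
def binaryPow : Program :=
  .seq (block [.const 17 1, .const 18 (1 / 2), .copy 15 17]) <|
  .seq (.while (.le 15 13) (.instr (.add 15 15 15))) <|
  .seq (block [.mul 15 15 18, .copy 16 13, .copy 14 17]) <|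
  .while (.le 17 15) <|
    .seq (.instr (.mul 14 14 14)) <|
    .seq (.ite (.le 15 16) (block [.sub 16 16 15, .mul 14 14 5]) .skip) <|
    .instr (.mul 15 15 18)

theorem binaryPow_oracleFree : binaryPow.OracleFree := by
  simp [binaryPow, Program.OracleFree, block]

theorem computesPow_binaryPow (N : ℕ) :
    ComputesPow binaryPow (fun e => ∃ m : ℕ, m < 2 ^ N ∧ e = m) (8 * N + 8) := by
  rintro σ hx ⟨m, hm, he⟩
  set x := σ.reg 5 with hxdef
  have h1 := runs_block [.const 17 1, .const 18 (1 / 2), .copy 15 17] (σ := σ)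
    (Q := fun τ => τ.reg 15 = 1 ∧ τ.reg 17 = 1 ∧ τ.reg 18 = 1 / 2 ∧
      (∀ r ≤ 13, τ.reg r = σ.reg r) ∧ τ.arr = σ.arr ∧ τ.idx = σ.idx)
    (by simp [BlockDefined, Instr.Defined]) (by
      refine ⟨by simp [Instr.run], by simp [Instr.run], by simp [Instr.run], ?_, rfl, rfl⟩
      intro r hr
      simp [Instr.run, Function.update, show r ≠ 15 by omega, show r ≠ 17 by omega,
        show r ≠ 18 by omega])
  -- the doubling loop stops at the first power of two above the exponent
  have h2 := fun τ hτ => runs_while (b := .le 15 13) (P := .instr (.add 15 15 15)) (T := 1)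
    (Q := fun τ => ∃ i ≤ N, m < 2 ^ i ∧ τ.reg 15 = 2 ^ i ∧ τ.reg 17 = 1 ∧ τ.reg 18 = 1 / 2 ∧
      (∀ r ≤ 13, τ.reg r = σ.reg r) ∧ τ.arr = σ.arr ∧ τ.idx = σ.idx)
    (fun n τ => ∃ i, i + n = N ∧ τ.reg 15 = 2 ^ i ∧ τ.reg 17 = 1 ∧ τ.reg 18 = 1 / 2 ∧
      (∀ r ≤ 13, τ.reg r = σ.reg r) ∧ τ.arr = σ.arr ∧ τ.idx = σ.idx)
    (by
      rintro n τ ⟨i, hi, h15, h17, h18, hr, ha, hidx⟩ hb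
      have hb' : (2 : ℝ) ^ i ≤ m := by
        have : τ.reg 15 ≤ τ.reg 13 := hb
        rwa [h15, hr 13 le_rfl, he] at this
      have hb'' : 2 ^ i ≤ m := by exact_mod_cast hb'
      have hlt : i < N := (Nat.pow_lt_pow_iff_right (by norm_num : 1 < 2)).1 (hb''.trans_lt hm)
      refine ⟨n - 1, by omega, runs_instr trivial
        ⟨i + 1, by omega, ?_, by simpa [Instr.run] using h17, by simpa [Instr.run] using h18,
          ?_, ha, hidx⟩⟩
      · simp [Instr.run, h15]; ring
      · intro r hr'
        simpa [Instr.run, Function.update, show r ≠ 15 by omega] using hr r hr')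
    (by
      rintro n τ ⟨i, hi, h15, h17, h18, hr, ha, hidx⟩ hb
      have hb' : ¬ (2 : ℝ) ^ i ≤ m := by
        intro h
        apply hb
        change τ.reg 15 ≤ τ.reg 13
        rwa [h15, hr 13 le_rfl, he]
      have hb'' : ¬ 2 ^ i ≤ m := by exact_mod_cast hb'
      exact ⟨i, by omega, by omega, h15, h17, h18, hr, ha, hidx⟩) N τ hτ
  -- the exponent is `r + q * 2 ^ j`, and the digits of `q` have been treated
  let I : ℕ → State → Prop := fun j τ => ∃ q r : ℕ, r < 2 ^ j ∧ m = r + q * 2 ^ j ∧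
    τ.reg 14 = x ^ q ∧ τ.reg 15 = 2 ^ j / 2 ∧ τ.reg 16 = r ∧ τ.reg 17 = 1 ∧ τ.reg 18 = 1 / 2 ∧
    (∀ r ≤ 13, τ.reg r = σ.reg r) ∧ τ.arr = σ.arr ∧ τ.idx = σ.idx
  have h3 := fun (i : ℕ) (hi : m < 2 ^ i) (τ : State) (h15 : τ.reg 15 = 2 ^ i)
      (h17 : τ.reg 17 = 1) (h18 : τ.reg 18 = 1 / 2) (hr : ∀ r ≤ 13, τ.reg r = σ.reg r)
      (ha : τ.arr = σ.arr) (hidx : τ.idx = σ.idx) =>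
    runs_block [.mul 15 15 18, .copy 16 13, .copy 14 17] (σ := τ) (Q := I i)
    (by simp [BlockDefined, Instr.Defined]) (by
      refine ⟨0, m, hi, by simp, by simp [Instr.run, h17], ?_, ?_, by simp [Instr.run, h17],
        by simp [Instr.run, h18], ?_, ha, hidx⟩
      · simp [Instr.run, h15, h18]; ring
      · simp [Instr.run, hr 13, he]
      · intro r hr'
        simpa [Instr.run, Function.update, show r ≠ 14 by omega, show r ≠ 15 by omega,
          show r ≠ 16 by omega] using hr r hr')
  have h4 := fun (i : ℕ) (τ : State) (hτ : I i τ) =>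
    runs_while (b := .le 17 15) (T := 1 + ((2 + 1) + 1))
    (P := .seq (.instr (.mul 14 14 14)) (.seq (.ite (.le 15 16)
      (block [.sub 16 16 15, .mul 14 14 5]) .skip) (.instr (.mul 15 15 18))))
    (Q := fun σ' => σ'.reg 14 = σ.reg 5 ^ σ.reg 13 ∧ (∀ r ≤ 13, σ'.reg r = σ.reg r) ∧
      σ'.arr = σ.arr ∧ σ'.idx = σ.idx) I
    (by
      rintro j τ ⟨q, r, hlt, hm', h14, h15, h16, h17, h18, hr, ha, hidx⟩ hb
      have hb' : (1 : ℝ) ≤ 2 ^ j / 2 := by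
        have : τ.reg 17 ≤ τ.reg 15 := hb
        rwa [h15, h17] at this
      obtain _ | j := j
      · norm_num at hb'
      have h15' : τ.reg 15 = 2 ^ j := by rw [h15]; ring
      refine ⟨j, rfl, ?_⟩
      refine (runs_instr (I := .mul 14 14 14) trivial
        (Q := fun τ' => τ' = Instr.run τ (.mul 14 14 14)) rfl).seq ?_
      rintro _ rfl
      refine Runs.seq (M := fun τ' => ∃ q r : ℕ, r < 2 ^ j ∧ m = r + q * 2 ^ j ∧
        τ'.reg 14 = x ^ q ∧ τ'.reg 15 = 2 ^ j ∧ τ'.reg 16 = r ∧ τ'.reg 17 = 1 ∧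
        τ'.reg 18 = 1 / 2 ∧
        (∀ r ≤ 13, τ'.reg r = σ.reg r) ∧ τ'.arr = σ.arr ∧ τ'.idx = σ.idx)
        (runs_ite (T := 2) (fun hb => ?_) (fun hb => ?_)) ?_
      · have hb' : (2 : ℝ) ^ j ≤ r := by
          have : τ.reg 15 ≤ τ.reg 16 := by simpa [Test.Holds, Instr.run] using hb
          rwa [h15', h16] at this
        have hb'' : 2 ^ j ≤ r := by exact_mod_cast hb'
        refine runs_block _ (by simp [BlockDefined, Instr.Defined])
          ⟨2 * q + 1, r - 2 ^ j, ?_, ?_, ?_, by simp [Instr.run, h15'], ?_,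
          by simp [Instr.run, h17], by simp [Instr.run, h18], ?_, ha, hidx⟩
        · rw [pow_succ] at hlt; omega
        · rw [hm', pow_succ]; zify [hb'']; ring
        · simp [Instr.run, h14, hr 5, ← hxdef]; ring
        · simp [Instr.run, h16, h15', hb'']
        · intro r hr'
          simpa [Instr.run, Function.update, show r ≠ 14 by omega, show r ≠ 16 by omega]
            using hr r hr'
      · have hb' : ¬ (2 : ℝ) ^ j ≤ r := by
          intro h
          apply hb
          simpa [Test.Holds, Instr.run, h15', h16] using h
        have hb'' : ¬ 2 ^ j ≤ r := by exact_mod_cast hb'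
        refine (runs_skip ?_).mono (by omega) (fun _ h => h)
        refine ⟨2 * q, r, by omega, ?_, ?_, by simp [Instr.run, h15'], by simp [Instr.run, h16],
          by simp [Instr.run, h17], by simp [Instr.run, h18], ?_, ha, hidx⟩
        · rw [hm', pow_succ]; ring
        · simp [Instr.run, h14]; ring
        · intro r hr'
          simpa [Instr.run, Function.update, show r ≠ 14 by omega] using hr r hr'
      · rintro τ' ⟨q, r, hlt, hm', h14, h15, h16, h17, h18, hr, ha, hidx⟩
        refine runs_instr trivial ⟨q, r, hlt, hm', by simpa [Instr.run] using h14, ?_,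
          by simpa [Instr.run] using h16, by simpa [Instr.run] using h17,
          by simpa [Instr.run] using h18, ?_, ha, hidx⟩
        · simp [Instr.run, h15, h18]; ring
        · intro r hr'
          simpa [Instr.run, Function.update, show r ≠ 15 by omega] using hr r hr')
    (by
      rintro j τ ⟨q, r, hlt, hm', h14, h15, h16, h17, h18, hr, ha, hidx⟩ hb
      refine ⟨?_, hr, ha, hidx⟩
      have hj : j = 0 := by
        by_contra hj
        apply hb
        change τ.reg 17 ≤ τ.reg 15
        obtain ⟨j, rfl⟩ := Nat.exists_eq_succ_of_ne_zero hj
        rw [h15, h17, pow_succ]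
        have : (1 : ℝ) ≤ 2 ^ j := one_le_pow₀ (by norm_num)
        linarith
      subst hj
      have hmq : m = q := by simp at hlt; simp [hm', hlt]
      rw [h14, he, hmq, Real.rpow_natCast]) i τ hτ
  refine Runs.mono (h1.seq (T' := (N * 2 + 1) + (3 + (N * 6 + 1))) fun τ hτ => ?_)
    (by simp; omega) (fun _ h => h)
  refine (h2 τ ⟨0, by simp, by simpa using hτ.1, hτ.2⟩).seq fun τ' hτ' => ?_
  obtain ⟨i, hiN, hi, h15, h17, h18, hr, ha, hidx⟩ := hτ'
  refine (h3 i hi τ' h15 h17 h18 hr ha hidx).seq fun τ'' hτ'' => ?_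
  exact (h4 i τ'' hτ'').mono (by omega) (fun _ h => h)

end RealRAM

/-! ### Exponential sums with one sign alternation -/

namespace ExpSum

section Weighted

variable {ι : Type*} [Fintype ι]

/-- The exponential sum with coefficients `c` and exponents `a`, divided by `x ^ m`. -/
noncomputable def shiftedSum (c a : ι → ℝ) (m x : ℝ) : ℝ := ∑ i, c i * x ^ (a i - m)

/-- The exponential sum with coefficients `c i * (a i - s)` and exponents `a i - m`. If `g` is the
exponential sum with coefficients `c` and exponents `a i - s`, this is `x ^ (s - m) * (x * g' x)`. -/
noncomputable def slopeSum (c a : ι → ℝ) (s m x : ℝ) : ℝ :=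
  ∑ i, c i * (a i - s) * x ^ (a i - m)

/-- The exponents above `s` have nonnegative and those below `s` nonpositive coefficients, and not
all coefficients vanish away from `s`. -/
def Oriented (c a : ι → ℝ) (s : ℝ) : Prop :=
  (∀ i, 0 ≤ c i * (a i - s)) ∧ ∃ i, 0 < c i * (a i - s)

variable {c a : ι → ℝ} {s m x y ρ : ℝ}

theorem shiftedSum_eq_rpow_mul (hx : 0 < x) (m s : ℝ) :
    shiftedSum c a m x = x ^ (s - m) * shiftedSum c a s x := by
  rw [shiftedSum, shiftedSum, Finset.mul_sum]
  refine Finset.sum_congr rfl fun i _ => ?_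
  rw [mul_left_comm, ← rpow_add hx]
  ring_nf

theorem Oriented.slopeSum_pos (h : Oriented c a s) (hx : 0 < x) : 0 < slopeSum c a s m x := by
  obtain ⟨i, hi⟩ := h.2
  exact Finset.sum_pos' (fun j _ => mul_nonneg (h.1 j) (rpow_pos_of_pos hx _).le)
    ⟨i, Finset.mem_univ _, mul_pos hi (rpow_pos_of_pos hx _)⟩

theorem Oriented.shiftedSum_lt (h : Oriented c a s) (hx : 0 < x) (hxy : x < y) :
    shiftedSum c a s x < shiftedSum c a s y := by
  have key : ∀ b e : ℝ, 0 < b * e → b * x ^ e < b * y ^ e := by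
    intro b e hbe
    rcases pos_and_pos_or_neg_and_neg_of_mul_pos hbe with ⟨hb, he⟩ | ⟨hb, he⟩
    · exact mul_lt_mul_of_pos_left (rpow_lt_rpow hx.le hxy he) hb
    · exact mul_lt_mul_of_neg_left (rpow_lt_rpow_of_neg hx hxy he) hb
  obtain ⟨i, hi⟩ := h.2
  refine Finset.sum_lt_sum (fun j _ => ?_) ⟨i, Finset.mem_univ _, key _ _ hi⟩
  rcases (h.1 j).lt_or_eq with hj | hj
  · exact (key _ _ hj).le
  · rcases mul_eq_zero.1 hj.symm with h0 | h0 <;> simp [h0]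

theorem Oriented.shiftedSum_pos_iff (h : Oriented c a s) (hx : 0 < x) (hρ : 0 < ρ)
    (h0 : shiftedSum c a m ρ = 0) : 0 < shiftedSum c a m x ↔ ρ < x := by
  rw [shiftedSum_eq_rpow_mul hρ m s] at h0
  have h0' : shiftedSum c a s ρ = 0 :=
    (mul_eq_zero.1 h0).resolve_left (rpow_pos_of_pos hρ _).ne'
  rw [shiftedSum_eq_rpow_mul hx m s, mul_pos_iff_of_pos_left (rpow_pos_of_pos hx _), ← h0']
  constructor
  · intro hlt
    by_contra hle
    rcases (not_lt.1 hle).lt_or_eq with h1 | h1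
    · exact lt_asymm hlt (h.shiftedSum_lt hx h1)
    · rw [h1] at hlt
      exact lt_irrefl _ hlt
  · exact h.shiftedSum_lt hρ

open Filter Topology in
/-- Since a negative power with a negative coefficient dominates near `0`, a positive value is
preceded by a root. -/
theorem Oriented.exists_root (h : Oriented c a s) (hj : ∃ j, c j < 0 ∧ a j < s) (hx : 0 < x)
    (hpos : 0 < shiftedSum c a m x) : ∃ ρ, 0 < ρ ∧ ρ < x ∧ shiftedSum c a m ρ = 0 := by
  obtain ⟨j, hcj, haj⟩ := hj
  classical
  have hbot : Tendsto (fun t => c j * t ^ (a j - s)) (𝓝[>] 0) atBot :=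
    (tendsto_rpow_neg_nhdsGT_zero (sub_neg.2 haj)).const_mul_atTop_of_neg hcj
  have hev : ∀ᶠ t in 𝓝[>] (0 : ℝ), t < min x 1 ∧ c j * t ^ (a j - s) < -∑ i, |c i| :=
    (eventually_nhdsWithin_of_eventually_nhds (eventually_lt_nhds (lt_min hx one_pos))).and
      (hbot.eventually_lt_atBot _)
  obtain ⟨t, ⟨ht1, ht2⟩, ht0⟩ := (hev.and self_mem_nhdsWithin).exists
  have ht0 : 0 < t := ht0
  have htx : t < x := ht1.trans_le (min_le_left _ _)
  have ht1 : t ≤ 1 := (ht1.trans_le (min_le_right _ _)).le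
  have hneg : shiftedSum c a s t < 0 := by
    have hle : ∑ i ∈ Finset.univ.erase j, c i * t ^ (a i - s) ≤ ∑ i, |c i| := by
      refine (Finset.sum_le_sum fun i _ => ?_).trans
        (Finset.sum_le_sum_of_subset_of_nonneg (Finset.erase_subset j _)
          fun i _ _ => abs_nonneg (c i))
      have hp := rpow_pos_of_pos ht0 (a i - s)
      rcases le_or_gt (c i) 0 with hc | hc
      · exact (mul_nonpos_of_nonpos_of_nonneg hc hp.le).trans (abs_nonneg _)
      · rw [abs_of_pos hc]
        have := (mul_nonneg_iff_of_pos_left hc).1 (h.1 i)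
        exact mul_le_of_le_one_right hc.le (rpow_le_one ht0.le ht1 this)
    rw [shiftedSum, ← Finset.add_sum_erase _ _ (Finset.mem_univ j)]
    linarith
  have hneg' : shiftedSum c a m t < 0 := by
    rw [shiftedSum_eq_rpow_mul ht0 m s]
    exact mul_neg_of_pos_of_neg (rpow_pos_of_pos ht0 _) hneg
  have hcont : ContinuousOn (shiftedSum c a m) (Set.Icc t x) := by
    refine continuousOn_finsetSum _ fun i _ => continuousOn_const.mul ?_
    exact continuousOn_id.rpow_const fun y hy => Or.inl (ht0.trans_le hy.1).ne'
  obtain ⟨ρ, ⟨hρ1, hρ2⟩, hρ⟩ := intermediate_value_Ioo htx.le hcont ⟨hneg', hpos⟩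
  exact ⟨ρ, ht0.trans hρ1, hρ2, hρ⟩

/-- The first order Taylor estimate of `v ^ b` at `1`, with an error proportional to `|b|`. -/
theorem abs_rpow_sub_one_sub_le {b v K : ℝ} (hK : |b| + 1 ≤ K) (hv : |v - 1| * (4 * K) ≤ 1) :
    |v ^ b - 1 - b * (v - 1)| ≤ |b| * (4 * K * |v - 1| ^ 2) := by
  have hK1 : 1 ≤ K := by linarith [abs_nonneg b]
  have hv4 : |v - 1| ≤ 1 / 4 := by nlinarith [abs_nonneg (v - 1)]
  have hpos : ∀ t ∈ Metric.closedBall (1 : ℝ) |v - 1|, 1 / 2 < t := by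
    intro t ht
    rw [Metric.mem_closedBall, Real.dist_eq] at ht
    linarith [neg_abs_le (t - 1)]
  have hderiv : ∀ t ∈ Metric.closedBall (1 : ℝ) |v - 1|,
      HasDerivWithinAt (fun t => t ^ b - b * t) (b * t ^ (b - 1) - b * 1)
        (Metric.closedBall (1 : ℝ) |v - 1|) t := by
    intro t ht
    exact ((hasDerivAt_rpow_const (Or.inl (by linarith [hpos t ht]))).sub
      ((hasDerivAt_id t).const_mul b)).hasDerivWithinAt
  have hbound : ∀ t ∈ Metric.closedBall (1 : ℝ) |v - 1|,
      ‖b * t ^ (b - 1) - b * 1‖ ≤ |b| * (4 * K * |v - 1|) := by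
    intro t ht
    have ht2 := hpos t ht
    have ht0 : 0 < t := by linarith
    rw [Metric.mem_closedBall, Real.dist_eq] at ht
    have hlog : |log t| ≤ 2 * |v - 1| := by
      refine le_trans ?_ (mul_le_mul_of_nonneg_left ht zero_le_two)
      have h1 := one_sub_inv_le_log_of_pos ht0
      have h2 := log_le_sub_one_of_pos ht0
      have h3 : t⁻¹ ≤ 2 := by rw [inv_le_comm₀ ht0 two_pos]; linarith
      have h4 : 1 - t⁻¹ = (t - 1) * t⁻¹ := by field_simp
      rw [abs_le]
      constructor
      · have : |(t - 1) * t⁻¹| ≤ |t - 1| * 2 := by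
          rw [abs_mul, abs_of_pos (inv_pos.2 ht0)]
          exact mul_le_mul_of_nonneg_left h3 (abs_nonneg _)
        linarith [neg_abs_le ((t - 1) * t⁻¹)]
      · linarith [le_abs_self (t - 1), abs_nonneg (t - 1)]
    have hprod : |log t * (b - 1)| ≤ 2 * |v - 1| * K := by
      rw [abs_mul]
      refine mul_le_mul hlog ?_ (abs_nonneg _) (by positivity)
      calc |b - 1| ≤ |b| + |1| := abs_sub _ _
        _ ≤ K := by rwa [abs_one]
    rw [← mul_sub, Real.norm_eq_abs, abs_mul, rpow_def_of_pos ht0]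
    refine mul_le_mul_of_nonneg_left ?_ (abs_nonneg _)
    have := abs_exp_sub_one_le (x := log t * (b - 1)) (by linarith)
    linarith
  have := (convex_closedBall (1 : ℝ) |v - 1|).norm_image_sub_le_of_norm_hasDerivWithin_le
    hderiv hbound (Metric.mem_closedBall_self (abs_nonneg _))
    (show v ∈ Metric.closedBall (1 : ℝ) |v - 1| by simp [Real.dist_eq])
  simp only [Real.norm_eq_abs, one_rpow] at this
  calc |v ^ b - 1 - b * (v - 1)| = |v ^ b - b * v - (1 - b * 1)| := by ring_nf
    _ ≤ _ := this
    _ = _ := by ring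

/-- One step of Newton's method, applied to the increasing function `x ^ (-s) * f x`. -/
theorem Oriented.newton (h : Oriented c a s) {K : ℝ} (hK : ∀ i, |a i - s| + 1 ≤ K) (hx : 0 < x)
    (hρ : 0 < ρ) (h0 : shiftedSum c a m ρ = 0) (hclose : |x - ρ| * (4 * K) ≤ x) :
    |x - x * (shiftedSum c a m x / slopeSum c a s m x) - ρ| ≤ 4 * K * (x - ρ) ^ 2 / x := by
  set v := ρ / x with hv
  have hρv : ρ = x * v := by rw [hv]; field_simp
  have hv0 : 0 < v := div_pos hρ hx
  have hxv : |x - ρ| = x * |v - 1| := by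
    rw [hρv, ← abs_of_pos hx, ← abs_mul, abs_sub_comm, abs_of_pos hx]; ring_nf
  have hvK : |v - 1| * (4 * K) ≤ 1 := by
    rw [hxv, mul_assoc] at hclose
    exact le_of_mul_le_mul_left (by linarith) hx
  have hS := h.slopeSum_pos (m := m) hx
  -- the root condition, multiplied by `x ^ (s - m) * ρ ^ (m - s)`
  have hroot : ∑ i, c i * x ^ (a i - m) * v ^ (a i - s) = 0 := by
    rw [shiftedSum_eq_rpow_mul hρ m s] at h0
    have h0' := (mul_eq_zero.1 h0).resolve_left (rpow_pos_of_pos hρ _).ne'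
    rw [← mul_eq_zero_of_right (x ^ (s - m)) h0', shiftedSum, Finset.mul_sum]
    refine Finset.sum_congr rfl fun i _ => ?_
    rw [hρv, mul_rpow hx.le hv0.le, show a i - m = (s - m) + (a i - s) by ring, rpow_add hx]
    ring
  have hsum : |shiftedSum c a m x + slopeSum c a s m x * (v - 1)| ≤
      slopeSum c a s m x * (4 * K * |v - 1| ^ 2) := by
    have : shiftedSum c a m x + slopeSum c a s m x * (v - 1) =
        -∑ i, c i * x ^ (a i - m) * (v ^ (a i - s) - 1 - (a i - s) * (v - 1)) := by
      rw [eq_neg_iff_add_eq_zero, slopeSum, shiftedSum, Finset.sum_mul, ← Finset.sum_add_distrib,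
        ← Finset.sum_add_distrib]
      refine (Finset.sum_congr rfl fun i _ => ?_).trans hroot
      ring
    rw [this, abs_neg, slopeSum, Finset.sum_mul]
    refine (Finset.abs_sum_le_sum_abs _ _).trans (Finset.sum_le_sum fun i _ => ?_)
    have hp := rpow_pos_of_pos hx (a i - m)
    calc _ = |c i| * x ^ (a i - m) * |v ^ (a i - s) - 1 - (a i - s) * (v - 1)| := by
          rw [abs_mul, abs_mul, abs_of_pos hp]
      _ ≤ |c i| * x ^ (a i - m) * (|a i - s| * (4 * K * |v - 1| ^ 2)) :=
          mul_le_mul_of_nonneg_left (abs_rpow_sub_one_sub_le (hK i) hvK) (by positivity)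
      _ = |c i * (a i - s)| * x ^ (a i - m) * (4 * K * |v - 1| ^ 2) := by rw [abs_mul]; ring
      _ = _ := by rw [abs_of_nonneg (h.1 i)]
  have hfinal : |shiftedSum c a m x / slopeSum c a s m x + (v - 1)| ≤ 4 * K * |v - 1| ^ 2 := by
    rw [show shiftedSum c a m x / slopeSum c a s m x + (v - 1) =
      (shiftedSum c a m x + slopeSum c a s m x * (v - 1)) / slopeSum c a s m x by field_simp,
      abs_div, abs_of_pos hS, div_le_iff₀ hS]
    linarith
  calc _ = |x * (shiftedSum c a m x / slopeSum c a s m x + (v - 1))| := by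
        rw [← abs_neg]; congr 1; rw [hρv]; ring
    _ ≤ x * (4 * K * |v - 1| ^ 2) := by
        rw [abs_mul, abs_of_pos hx]
        exact mul_le_mul_of_nonneg_left hfinal hx.le
    _ = 4 * K * (x - ρ) ^ 2 / x := by
        rw [← sq_abs (x - ρ), hxv]; field_simp

end Weighted

/-! ### Sign alternations -/

variable {k : ℕ} {f : ExpSum k}

theorem exists_adjacent_alternation {i j : Fin k} (hc : f.coeff i * f.coeff j < 0)
    (ha : f.expo i < f.expo j) : ∃ p : Fin k × Fin k, f.expo i ≤ f.expo p.1 ∧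
      f.expo p.2 ≤ f.expo j ∧ f.coeff p.1 * f.coeff p.2 < 0 ∧ f.expo p.1 < f.expo p.2 ∧
      ∀ l, ¬ (f.expo p.1 < f.expo l ∧ f.expo l < f.expo p.2) := by
  classical
  -- the closest pair of exponents with coefficients of opposite signs
  obtain ⟨p, hp, hmin⟩ := Finset.exists_min_image
    (Finset.univ.filter fun p : Fin k × Fin k => f.expo i ≤ f.expo p.1 ∧
      f.expo p.2 ≤ f.expo j ∧ f.coeff p.1 * f.coeff p.2 < 0 ∧ f.expo p.1 < f.expo p.2)
    (fun p => f.expo p.2 - f.expo p.1) ⟨(i, j), by simp [hc, ha]⟩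
  simp only [Finset.mem_filter, Finset.mem_univ, true_and] at hp hmin
  obtain ⟨h1, h2, h3, h4⟩ := hp
  refine ⟨p, h1, h2, h3, h4, fun l ⟨hl1, hl2⟩ => ?_⟩
  rcases lt_or_gt_of_ne (f.coeff_ne_zero l) with hl | hl <;>
    rcases mul_neg_iff.1 h3 with ⟨h5, h6⟩ | ⟨h5, h6⟩
  · linarith [hmin (p.1, l) ⟨h1, by linarith, mul_neg_of_pos_of_neg h5 hl, hl1⟩]
  · linarith [hmin (l, p.2) ⟨by linarith, h2, mul_neg_of_neg_of_pos hl h6, hl2⟩]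
  · linarith [hmin (l, p.2) ⟨by linarith, h2, mul_neg_of_pos_of_neg hl h6, hl2⟩]
  · linarith [hmin (p.1, l) ⟨h1, by linarith, mul_neg_of_neg_of_pos h5 hl, hl1⟩]

theorem not_two_alternations (hf : f.signAlternations ≤ 1) {i j l : Fin k}
    (hij : f.coeff i * f.coeff j < 0) (hjl : f.coeff j * f.coeff l < 0)
    (ha : f.expo i < f.expo j) (ha' : f.expo j < f.expo l) : False := by
  obtain ⟨p, -, hp2, hp⟩ := exists_adjacent_alternation hij ha
  obtain ⟨q, hq1, -, hq⟩ := exists_adjacent_alternation hjl ha'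
  have := (Set.ncard_le_one (Set.toFinite _)).1 hf p hp q hq
  subst this
  linarith [hp.2.1]

/-- `s` is the lowest exponent of the upper one of the two groups of terms with equal signs. -/
def Separates (f : ExpSum k) (s : ℝ) : Prop :=
  ∃ e : ℝ, (e = 1 ∨ e = -1) ∧ Oriented (fun i => e * f.coeff i) f.expo s ∧
    ∃ j, e * f.coeff j < 0 ∧ f.expo j < s

/-- What the scanning of the input finds: `p` and `q` are the lowest exponents of a positive and of
a negative coefficient (or the largest exponent `b`, if there is no such coefficient). -/
structure Scanned (f : ExpSum k) (b p q : ℝ) : Prop where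
  le_top : ∀ i, f.expo i ≤ b
  top_mem : ∃ i, f.expo i = b
  pos_le : ∀ i, 0 < f.coeff i → p ≤ f.expo i
  neg_le : ∀ i, f.coeff i < 0 → q ≤ f.expo i
  pos_mem : p = b ∨ ∃ i, 0 < f.coeff i ∧ f.expo i = p
  neg_mem : q = b ∨ ∃ i, f.coeff i < 0 ∧ f.expo i = q

theorem Scanned.min_le {b p q : ℝ} (h : Scanned f b p q) (i : Fin k) : min p q ≤ f.expo i := by
  rcases lt_or_gt_of_ne (f.coeff_ne_zero i) with hc | hc
  · exact (min_le_right _ _).trans (h.neg_le i hc)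
  · exact (min_le_left _ _).trans (h.pos_le i hc)

theorem Scanned.exists_eq_left {b p q : ℝ} (h : Scanned f b p q) : ∃ i, f.expo i = p := by
  rcases h.pos_mem with hp | ⟨i, -, hi⟩
  · exact hp ▸ h.top_mem
  · exact ⟨i, hi⟩

theorem Scanned.exists_eq_right {b p q : ℝ} (h : Scanned f b p q) : ∃ i, f.expo i = q := by
  rcases h.neg_mem with hp | ⟨i, -, hi⟩
  · exact hp ▸ h.top_mem
  · exact ⟨i, hi⟩

theorem Scanned.exists_eq_min {b p q : ℝ} (h : Scanned f b p q) : ∃ i, f.expo i = min p q := by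
  rcases min_choice p q with h' | h' <;> rw [h']
  exacts [h.exists_eq_left, h.exists_eq_right]

theorem Scanned.exists_eq_max {b p q : ℝ} (h : Scanned f b p q) : ∃ i, f.expo i = max p q := by
  rcases max_choice p q with h' | h' <;> rw [h']
  exacts [h.exists_eq_left, h.exists_eq_right]

theorem separates_of_lt (hf : f.signAlternations ≤ 1) {e p q : ℝ} (he : e = 1 ∨ e = -1)
    (hqp : q < p) (hp : ∀ i, 0 < e * f.coeff i → p ≤ f.expo i)
    (hpm : ∃ i, 0 < e * f.coeff i ∧ f.expo i = p)
    (hqm : ∃ i, e * f.coeff i < 0 ∧ f.expo i = q) : f.Separates p := by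
  obtain ⟨i, hci, hai⟩ := hpm
  obtain ⟨j, hcj, haj⟩ := hqm
  have hee : e * e = 1 := by rcases he with rfl | rfl <;> norm_num
  have hlow : ∀ l, e * f.coeff l < 0 → f.expo l ≤ p := by
    intro l hl
    by_contra! hpl
    refine not_two_alternations hf (i := j) (j := i) (l := l) ?_ ?_ (by linarith) (by linarith)
    · have := mul_neg_of_neg_of_pos hcj hci
      linear_combination this - f.coeff i * f.coeff j * hee
    · have := mul_neg_of_pos_of_neg hci hl
      linear_combination this - f.coeff i * f.coeff l * hee
  refine ⟨e, he, ⟨fun l => ?_, j, mul_pos_of_neg_of_neg hcj (by linarith)⟩, j, hcj, by linarith⟩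
  have hne : e * f.coeff l ≠ 0 := by
    refine mul_ne_zero ?_ (f.coeff_ne_zero l)
    rcases he with rfl | rfl <;> norm_num
  rcases lt_or_gt_of_ne hne with hc | hc
  · exact mul_nonneg_of_nonpos_of_nonpos hc.le (by linarith [hlow l hc])
  · exact mul_nonneg hc.le (by linarith [hp l hc])

theorem eval_eq_rpow_mul {x : ℝ} (hx : 0 < x) (m : ℝ) :
    f.eval x = x ^ m * shiftedSum f.coeff f.expo m x := by
  have := shiftedSum_eq_rpow_mul (c := f.coeff) (a := f.expo) hx 0 m
  simpa [shiftedSum, eval] using this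

theorem eval_eq_zero_iff {x : ℝ} (hx : 0 < x) (m : ℝ) :
    f.eval x = 0 ↔ shiftedSum f.coeff f.expo m x = 0 := by
  rw [eval_eq_rpow_mul hx m, mul_eq_zero, or_iff_right (rpow_pos_of_pos hx _).ne']

/-- Without an alternation, the sum and the slope sum have opposite signs, because then every
exponent is at most `max p q`. -/
theorem Scanned.separates_or (hf : f.signAlternations ≤ 1) {b p q : ℝ} (h : Scanned f b p q) :
    f.Separates (max p q) ∨ ∀ x, 0 < x → f.eval x ≠ 0 ∧ ∀ m,
      shiftedSum f.coeff f.expo m x * slopeSum f.coeff f.expo (max p q) m x ≤ 0 := by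
  obtain ⟨i₀, hi₀⟩ := h.top_mem
  by_cases hpos : ∃ i, 0 < f.coeff i
  · by_cases hneg : ∃ i, f.coeff i < 0
    · left
      have hpm : ∃ i, 0 < f.coeff i ∧ f.expo i = p := by
        obtain ⟨i, hi⟩ := hpos
        rcases h.pos_mem with hp | hp
        · exact ⟨i, hi, le_antisymm (hp ▸ h.le_top i) (h.pos_le i hi)⟩
        · exact hp
      have hqm : ∃ i, f.coeff i < 0 ∧ f.expo i = q := by
        obtain ⟨i, hi⟩ := hneg
        rcases h.neg_mem with hq | hq
        · exact ⟨i, hi, le_antisymm (hq ▸ h.le_top i) (h.neg_le i hi)⟩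
        · exact hq
      rcases lt_trichotomy p q with hpq | hpq | hpq
      · rw [max_eq_right hpq.le]
        exact separates_of_lt hf (e := -1) (Or.inr rfl) hpq
          (by simpa using h.neg_le) (by simpa using hqm) (by simpa using hpm)
      · obtain ⟨i, hi, hai⟩ := hpm
        obtain ⟨j, hj, haj⟩ := hqm
        have : i = j := f.expo_injective (by rw [hai, haj, hpq])
        subst this
        exact absurd hi hj.le.not_gt
      · rw [max_eq_left hpq.le]
        exact separates_of_lt hf (e := 1) (Or.inl rfl) hpq
          (by simpa using h.pos_le) (by simpa using hpm) (by simpa using hqm)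
    · right
      push Not at hneg
      have hc : ∀ i, 0 < f.coeff i := fun i => (hneg i).lt_of_ne' (f.coeff_ne_zero i)
      have hq : q = b := h.neg_mem.resolve_right fun ⟨i, hi, _⟩ => (hneg i).not_gt hi
      intro x hx
      have hS : ∀ m, 0 < shiftedSum f.coeff f.expo m x := fun m =>
        Finset.sum_pos (fun i _ => mul_pos (hc i) (rpow_pos_of_pos hx _)) ⟨i₀, Finset.mem_univ _⟩
      refine ⟨fun h0 => (hS 0).ne' ((eval_eq_zero_iff hx 0).1 h0), fun m => ?_⟩
      refine mul_nonpos_of_nonneg_of_nonpos (hS m).le (Finset.sum_nonpos fun i _ => ?_)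
      refine mul_nonpos_of_nonpos_of_nonneg (mul_nonpos_of_nonneg_of_nonpos (hc i).le ?_)
        (rpow_pos_of_pos hx _).le
      linarith [h.le_top i, le_max_right p q]
  · right
    push Not at hpos
    have hc : ∀ i, f.coeff i < 0 := fun i => (hpos i).lt_of_ne (f.coeff_ne_zero i)
    have hp : p = b := h.pos_mem.resolve_right fun ⟨i, hi, _⟩ => (hpos i).not_gt hi
    intro x hx
    have hS : ∀ m, shiftedSum f.coeff f.expo m x < 0 := fun m =>
      Finset.sum_neg (fun i _ => mul_neg_of_neg_of_pos (hc i) (rpow_pos_of_pos hx _))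
        ⟨i₀, Finset.mem_univ _⟩
    refine ⟨fun h0 => (hS 0).ne ((eval_eq_zero_iff hx 0).1 h0), fun m => ?_⟩
    refine mul_nonpos_of_nonpos_of_nonneg (hS m).le (Finset.sum_nonneg fun i _ => ?_)
    refine mul_nonneg (mul_nonneg_of_nonpos_of_nonpos (hc i).le ?_) (rpow_pos_of_pos hx _).le
    linarith [h.le_top i, le_max_left p q]

section Separates

variable {s x ρ : ℝ} (m : ℝ)

theorem shiftedSum_const_mul (e : ℝ) :
    shiftedSum (fun i => e * f.coeff i) f.expo m x = e * shiftedSum f.coeff f.expo m x := by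
  simp only [shiftedSum, Finset.mul_sum, mul_assoc]

theorem slopeSum_const_mul (e : ℝ) :
    slopeSum (fun i => e * f.coeff i) f.expo s m x = e * slopeSum f.coeff f.expo s m x := by
  simp only [slopeSum, Finset.mul_sum, mul_assoc]

theorem Separates.slopeSum_ne_zero (h : f.Separates s) (hx : 0 < x) :
    slopeSum f.coeff f.expo s m x ≠ 0 := by
  obtain ⟨e, -, ho, -⟩ := h
  have := ho.slopeSum_pos (m := m) hx
  rw [slopeSum_const_mul] at this
  exact right_ne_zero_of_mul this.ne'

/-- The product of the sum and the slope sum does not depend on the orientation. -/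
theorem Separates.exists_oriented (h : f.Separates s) (hx : 0 < x) :
    ∃ e : ℝ, e ≠ 0 ∧ Oriented (fun i => e * f.coeff i) f.expo s ∧
      (∃ j, e * f.coeff j < 0 ∧ f.expo j < s) ∧
      (0 < shiftedSum f.coeff f.expo m x * slopeSum f.coeff f.expo s m x ↔
        0 < shiftedSum (fun i => e * f.coeff i) f.expo m x) := by
  obtain ⟨e, he, ho, hj⟩ := h
  refine ⟨e, by rcases he with rfl | rfl <;> norm_num, ho, hj, ?_⟩
  have hS := ho.slopeSum_pos (m := m) hx
  rw [slopeSum_const_mul] at hS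
  rw [shiftedSum_const_mul]
  refine Iff.trans ?_ (mul_pos_iff_of_pos_right hS)
  rcases he with rfl | rfl <;> simp

theorem Separates.pos_iff (h : f.Separates s) (hx : 0 < x) (hρ : 0 < ρ) (h0 : f.eval ρ = 0) :
    0 < shiftedSum f.coeff f.expo m x * slopeSum f.coeff f.expo s m x ↔ ρ < x := by
  obtain ⟨e, -, ho, -, hiff⟩ := h.exists_oriented m hx
  rw [hiff]
  exact ho.shiftedSum_pos_iff hx hρ
    (by rw [shiftedSum_const_mul, (eval_eq_zero_iff hρ m).1 h0, mul_zero])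

theorem Separates.exists_root (h : f.Separates s) (hx : 0 < x)
    (hpos : 0 < shiftedSum f.coeff f.expo m x * slopeSum f.coeff f.expo s m x) :
    ∃ ρ, 0 < ρ ∧ ρ < x ∧ f.eval ρ = 0 := by
  obtain ⟨e, he, ho, hj, hiff⟩ := h.exists_oriented m hx
  obtain ⟨ρ, h1, h2, h3⟩ := ho.exists_root hj hx (hiff.1 hpos)
  rw [shiftedSum_const_mul] at h3
  exact ⟨ρ, h1, h2, (eval_eq_zero_iff h1 m).2 ((mul_eq_zero.1 h3).resolve_left he)⟩

theorem Separates.newton (h : f.Separates s) {K : ℝ} (hK : ∀ i, |f.expo i - s| + 1 ≤ K)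
    (hx : 0 < x) (hρ : 0 < ρ) (h0 : f.eval ρ = 0) (hclose : |x - ρ| * (4 * K) ≤ x) :
    |x - x * (shiftedSum f.coeff f.expo m x / slopeSum f.coeff f.expo s m x) - ρ| ≤
      4 * K * (x - ρ) ^ 2 / x := by
  obtain ⟨e, he, ho, -⟩ := h.exists_oriented m hx
  have := ho.newton (m := m) hK hx hρ
    (by rw [shiftedSum_const_mul, (eval_eq_zero_iff hρ m).1 h0, mul_zero]) hclose
  rwa [shiftedSum_const_mul, slopeSum_const_mul, mul_div_mul_left _ _ he] at this

end Separates

/-! ### The degree -/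

theorem sub_le_degree (i j : Fin k) : f.expo i - f.expo j ≤ f.degree := by
  have h1 : ∀ p : Fin k × Fin k, f.expo p.1 - f.expo p.2 ≤ f.spread := fun p =>
    le_ciSup (f := fun p : Fin k × Fin k => f.expo p.1 - f.expo p.2)
      (Set.finite_range _).bddAbove p
  have h2 := h1 (i, j)
  rw [degree]
  split_ifs
  · exact h2
  by_cases hij : i = j
  · subst hij
    rw [sub_self]
    refine div_nonneg (by simpa using h2) (le_min zero_le_one ?_)
    exact Real.iInf_nonneg fun _ => abs_nonneg _
  · have hne : Nonempty {p : Fin k × Fin k // p.1 ≠ p.2} := ⟨⟨(i, j), hij⟩⟩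
    obtain ⟨p, hp⟩ := exists_eq_ciInf_of_finite
      (f := fun p : {p : Fin k × Fin k // p.1 ≠ p.2} => |f.expo p.1.1 - f.expo p.1.2|)
    have hgap : 0 < f.minGap := by
      rw [minGap, ← hp, abs_pos, sub_ne_zero]
      exact fun h => p.2 (f.expo_injective h)
    have h0 : 0 ≤ f.spread := by simpa using h1 (i, i)
    exact h2.trans (le_div_self h0 (lt_min one_pos hgap) (min_le_left _ _))

end ExpSum

namespace RealRAM

open ExpSum

variable {k : ℕ} {f : ExpSum k} {R ε : ℝ}

/-! ### The memory during the computation -/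

/-- The input is still in its place, and register `9` holds zero. -/
structure Loaded (f : ExpSum k) (R ε : ℝ) (σ : State) : Prop where
  idx_zero : σ.idx 0 = k
  coeff : ∀ i : Fin k, σ.arr 0 i = f.coeff i
  expo : ∀ i : Fin k, σ.arr 1 i = f.expo i
  reg_zero : σ.reg 0 = R
  reg_one : σ.reg 1 = ε
  reg_nine : σ.reg 9 = 0

theorem loaded_input (f : ExpSum k) (R ε : ℝ) : Loaded f R ε (input f R ε) := by
  constructor <;> simp [input]

theorem Loaded.congr {σ σ' : State} (h : Loaded f R ε σ) (h0 : σ'.idx 0 = σ.idx 0)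
    (ha : σ'.arr 0 = σ.arr 0) (ha' : σ'.arr 1 = σ.arr 1) (hr0 : σ'.reg 0 = σ.reg 0)
    (hr1 : σ'.reg 1 = σ.reg 1) (hr9 : σ'.reg 9 = σ.reg 9) : Loaded f R ε σ' :=
  ⟨h0.trans h.1, by rw [ha]; exact h.2, by rw [ha']; exact h.3, hr0.trans h.4, hr1.trans h.5,
    hr9.trans h.6⟩

/-- The input is still in its place, and registers `2`, `3`, `4` hold the separating exponent `s`,
the lowest exponent `m` and the bound `B`. -/
structure Prepared (f : ExpSum k) (R ε s m B : ℝ) (σ : State) : Prop extends Loaded f R ε σ where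
  reg_two : σ.reg 2 = s
  reg_three : σ.reg 3 = m
  reg_four : σ.reg 4 = B

variable {s m B : ℝ}

theorem Prepared.congr {σ σ' : State} (h : Prepared f R ε s m B σ) (h0 : σ'.idx 0 = σ.idx 0)
    (ha : σ'.arr 0 = σ.arr 0) (ha' : σ'.arr 1 = σ.arr 1) (hr0 : σ'.reg 0 = σ.reg 0)
    (hr1 : σ'.reg 1 = σ.reg 1) (hr2 : σ'.reg 2 = σ.reg 2) (hr3 : σ'.reg 3 = σ.reg 3)
    (hr4 : σ'.reg 4 = σ.reg 4) (hr9 : σ'.reg 9 = σ.reg 9) : Prepared f R ε s m B σ' :=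
  ⟨h.toLoaded.congr h0 ha ha' hr0 hr1 hr9, hr2.trans h.2, hr3.trans h.3, hr4.trans h.4⟩

/-! ### Scanning the input -/

/-- Register `4` receives the largest exponent. -/
def scanTop : Program :=
  .seq (block [.iconst 1 0, .load 4 1 1]) <|
  .while (.ilt 1 0) <|
    .seq (.instr (.load 12 1 1)) <|
    .seq (.ite (.lt 4 12) (.instr (.copy 4 12)) .skip) <|
    .instr (.isucc 1)

/-- Registers `2` and `3` receive the lowest exponents of the positive and of the negative
coefficients. -/
def scanSigns : Program :=
  .seq (block [.copy 2 4, .copy 3 4, .iconst 1 0]) <|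
  .while (.ilt 1 0) <|
    .seq (block [.load 12 1 1, .load 13 0 1]) <|
    .seq (.ite (.lt 9 13) (.ite (.lt 12 2) (.instr (.copy 2 12)) .skip)
      (.ite (.lt 12 3) (.instr (.copy 3 12)) .skip)) <|
    .instr (.isucc 1)

/-- Registers `2`, `3`, `4` receive the separating exponent, the lowest exponent, and sixteen times
the spread plus one. -/
def prepare : Program :=
  .seq scanTop <| .seq scanSigns <|
  .seq (.ite (.lt 2 3) (block [.copy 12 2, .copy 2 3, .copy 3 12]) .skip) <|
  block [.sub 4 4 3, .const 12 1, .add 4 4 12, .const 12 16, .mul 4 4 12]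

theorem runs_scanTop (hk : 1 ≤ k) {σ : State} (hσ : Loaded f R ε σ) :
    Runs scanTop σ (5 * k + 3) fun σ' => Loaded f R ε σ' ∧ (∀ i, f.expo i ≤ σ'.reg 4) ∧
      ∃ i, f.expo i = σ'.reg 4 := by
  let I : ℕ → State → Prop := fun n τ => ∃ i, i + n = k ∧ τ.idx 1 = i ∧ Loaded f R ε τ ∧
    (∀ j : Fin k, j < i → f.expo j ≤ τ.reg 4) ∧ ∃ j, f.expo j = τ.reg 4
  refine Runs.mono (Runs.seq (T := 2) (T' := k * 5 + 1) (M := I k) ?_ ?_) (by omega)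
    (fun _ h => h)
  · refine runs_block _ (by simp [BlockDefined, Instr.Defined]) ⟨0, by omega, rfl,
      hσ.congr rfl rfl rfl rfl rfl rfl, by simp, ⟨0, hk⟩, ?_⟩
    simpa [Instr.run] using (hσ.expo ⟨0, hk⟩).symm
  · refine runs_while (T := 1 + (2 + 1)) I ?_ ?_ k
    · rintro n τ ⟨i, hi, hi1, hL, hle, j, hj⟩ hb
      have hik : i < k := by simpa [Test.Holds, hi1, hL.idx_zero] using hb
      refine ⟨n - 1, by omega, ?_⟩
      have h12 : (Instr.run τ (.load 12 1 1)).reg 12 = f.expo ⟨i, hik⟩ := by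
        simpa [Instr.run, hi1] using hL.expo ⟨i, hik⟩
      refine (runs_instr (I := .load 12 1 1) trivial (Q := fun τ' =>
        τ' = Instr.run τ (.load 12 1 1)) rfl).seq ?_
      rintro _ rfl
      refine Runs.seq (M := fun τ' => τ'.idx 1 = i ∧ Loaded f R ε τ' ∧
        (∀ j : Fin k, j < i + 1 → f.expo j ≤ τ'.reg 4) ∧ ∃ j, f.expo j = τ'.reg 4)
        (runs_ite (T := 1) (fun hb => ?_) (fun hb => ?_)) ?_
      · have hb' : τ.reg 4 < f.expo ⟨i, hik⟩ := by rw [← h12]; exact hb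
        refine runs_instr trivial ⟨hi1, hL.congr rfl rfl rfl rfl rfl rfl, ?_, ⟨i, hik⟩, h12.symm⟩
        intro l hl
        refine le_trans ?_ h12.ge
        rcases Nat.lt_succ_iff_lt_or_eq.1 hl with h | h
        · exact (hle l h).trans hb'.le
        · exact (congrArg f.expo (Fin.ext h)).le
      · have hb' : f.expo ⟨i, hik⟩ ≤ τ.reg 4 := by rw [← h12]; exact not_lt.1 hb
        refine (runs_skip ?_).mono (by omega) (fun _ h => h)
        refine ⟨hi1, hL.congr rfl rfl rfl rfl rfl rfl, ?_, j, hj⟩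
        intro l hl
        rcases Nat.lt_succ_iff_lt_or_eq.1 hl with h | h
        · exact hle l h
        · exact (congrArg f.expo (Fin.ext h)).le.trans hb'
      · rintro τ' ⟨h1, h2, h3, h4⟩
        exact runs_instr trivial ⟨i + 1, by omega, by simp [Instr.run, h1],
          h2.congr rfl rfl rfl rfl rfl rfl, h3, h4⟩
    · rintro n τ ⟨i, hi, hi1, hL, hle, hj⟩ hb
      have hik : ¬ i < k := by simpa [Test.Holds, hi1, hL.idx_zero] using hb
      exact ⟨hL, fun j => hle j (by omega), hj⟩

theorem runs_scanSigns {σ : State} (hσ : Loaded f R ε σ) (hle : ∀ i, f.expo i ≤ σ.reg 4)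
    (htop : ∃ i, f.expo i = σ.reg 4) :
    Runs scanSigns σ (7 * k + 4) fun σ' => Loaded f R ε σ' ∧
      Scanned f (σ'.reg 4) (σ'.reg 2) (σ'.reg 3) := by
  let J : ℕ → State → Prop := fun i τ => Loaded f R ε τ ∧ τ.reg 4 = σ.reg 4 ∧
    (∀ j : Fin k, j < i → 0 < f.coeff j → τ.reg 2 ≤ f.expo j) ∧
    (∀ j : Fin k, j < i → f.coeff j < 0 → τ.reg 3 ≤ f.expo j) ∧
    (τ.reg 2 = σ.reg 4 ∨ ∃ j, 0 < f.coeff j ∧ f.expo j = τ.reg 2) ∧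
    (τ.reg 3 = σ.reg 4 ∨ ∃ j, f.coeff j < 0 ∧ f.expo j = τ.reg 3)
  let I : ℕ → State → Prop := fun n τ => ∃ i, i + n = k ∧ τ.idx 1 = i ∧ J i τ
  refine Runs.mono (Runs.seq (T := 3) (T' := k * 7 + 1) (M := I k) ?_ ?_) (by omega)
    (fun _ h => h)
  · exact runs_block _ (by simp [BlockDefined, Instr.Defined]) ⟨0, by omega, rfl,
      hσ.congr rfl rfl rfl rfl rfl rfl, rfl, by simp, by simp, Or.inl rfl, Or.inl rfl⟩
  · refine runs_while (T := 2 + (3 + 1)) I ?_ ?_ k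
    · rintro n τ ⟨i, hi, hi1, hL, h4, hp, hq, hpm, hqm⟩ hb
      have hik : i < k := by simpa [Test.Holds, hi1, hL.idx_zero] using hb
      refine ⟨n - 1, by omega, ?_⟩
      refine (runs_block [.load 12 1 1, .load 13 0 1] (by simp [BlockDefined, Instr.Defined])
        (Q := fun τ' => τ'.idx 1 = i ∧ J i τ' ∧ τ'.reg 12 = f.expo ⟨i, hik⟩ ∧
          τ'.reg 13 = f.coeff ⟨i, hik⟩) ?_).seq ?_
      · refine ⟨hi1, ⟨hL.congr rfl rfl rfl rfl rfl rfl, h4, hp, hq, hpm, hqm⟩, ?_, ?_⟩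
        · simpa [Instr.run, hi1] using hL.expo ⟨i, hik⟩
        · simpa [Instr.run, hi1] using hL.coeff ⟨i, hik⟩
      clear hL h4 hp hq hpm hqm
      rintro τ' ⟨hi1, ⟨hL, h4, hp, hq, hpm, hqm⟩, h12, h13⟩
      have h9 := hL.reg_nine
      refine Runs.seq (M := fun τ' => τ'.idx 1 = i ∧ J (i + 1) τ')
        (runs_ite (T := 2) (fun hb => ?_) (fun hb => ?_)) ?_
      · have hc : 0 < f.coeff ⟨i, hik⟩ := by rw [← h13, ← h9]; exact hb
        have hq' : ∀ j : Fin k, j < i + 1 → f.coeff j < 0 → τ'.reg 3 ≤ f.expo j := by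
          intro l hl hcl
          rcases Nat.lt_succ_iff_lt_or_eq.1 hl with h | h
          · exact hq l h hcl
          · obtain rfl : l = ⟨i, hik⟩ := Fin.ext h
            exact absurd hc hcl.not_gt
        refine runs_ite (T := 1) (fun hb => ?_) (fun hb => ?_)
        · have hb' : f.expo ⟨i, hik⟩ < τ'.reg 2 := by rw [← h12]; exact hb
          refine runs_instr trivial ⟨hi1, hL.congr rfl rfl rfl rfl rfl rfl, h4, ?_, hq',
            Or.inr ⟨⟨i, hik⟩, hc, h12.symm⟩, hqm⟩
          intro l hl hcl
          refine h12.le.trans ?_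
          rcases Nat.lt_succ_iff_lt_or_eq.1 hl with h | h
          · exact hb'.le.trans (hp l h hcl)
          · exact (congrArg f.expo (Fin.ext h)).ge
        · have hb' : τ'.reg 2 ≤ f.expo ⟨i, hik⟩ := by rw [← h12]; exact not_lt.1 hb
          refine (runs_skip ?_).mono (by omega) (fun _ h => h)
          refine ⟨hi1, hL, h4, ?_, hq', hpm, hqm⟩
          intro l hl hcl
          rcases Nat.lt_succ_iff_lt_or_eq.1 hl with h | h
          · exact hp l h hcl
          · exact hb'.trans (congrArg f.expo (Fin.ext h)).ge
      · have hc : f.coeff ⟨i, hik⟩ < 0 := by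
          refine lt_of_le_of_ne ?_ (f.coeff_ne_zero _)
          rw [← h13, ← h9]
          exact not_lt.1 hb
        have hp' : ∀ j : Fin k, j < i + 1 → 0 < f.coeff j → τ'.reg 2 ≤ f.expo j := by
          intro l hl hcl
          rcases Nat.lt_succ_iff_lt_or_eq.1 hl with h | h
          · exact hp l h hcl
          · obtain rfl : l = ⟨i, hik⟩ := Fin.ext h
            exact absurd hc hcl.not_gt
        refine runs_ite (T := 1) (fun hb => ?_) (fun hb => ?_)
        · have hb' : f.expo ⟨i, hik⟩ < τ'.reg 3 := by rw [← h12]; exact hb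
          refine runs_instr trivial ⟨hi1, hL.congr rfl rfl rfl rfl rfl rfl, h4, hp', ?_,
            hpm, Or.inr ⟨⟨i, hik⟩, hc, h12.symm⟩⟩
          intro l hl hcl
          refine h12.le.trans ?_
          rcases Nat.lt_succ_iff_lt_or_eq.1 hl with h | h
          · exact hb'.le.trans (hq l h hcl)
          · exact (congrArg f.expo (Fin.ext h)).ge
        · have hb' : τ'.reg 3 ≤ f.expo ⟨i, hik⟩ := by rw [← h12]; exact not_lt.1 hb
          refine (runs_skip ?_).mono (by omega) (fun _ h => h)
          refine ⟨hi1, hL, h4, hp', ?_, hpm, hqm⟩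
          intro l hl hcl
          rcases Nat.lt_succ_iff_lt_or_eq.1 hl with h | h
          · exact hq l h hcl
          · exact hb'.trans (congrArg f.expo (Fin.ext h)).ge
      · rintro τ'' ⟨h1, hL, hJ⟩
        exact runs_instr trivial ⟨i + 1, by omega, by simp [Instr.run, h1],
          hL.congr rfl rfl rfl rfl rfl rfl, hJ⟩
    · rintro n τ ⟨i, hi, hi1, hL, h4, hp, hq, hpm, hqm⟩ hb
      have hik : ¬ i < k := by simpa [Test.Holds, hi1, hL.idx_zero] using hb
      refine ⟨hL, h4 ▸ hle, h4 ▸ htop, fun j => hp j (by omega), fun j => hq j (by omega),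
        h4 ▸ hpm, h4 ▸ hqm⟩

theorem runs_prepare (hk : 1 ≤ k) {σ : State} (hσ : Loaded f R ε σ) :
    Runs prepare σ (12 * k + 16) fun σ' => ∃ b p q, Scanned f b p q ∧
      Prepared f R ε (max p q) (min p q) ((b - min p q + 1) * 16) σ' := by
  refine Runs.mono ((runs_scanTop hk hσ).seq (T' := 7 * k + 4 + (4 + 5)) ?_) (by omega)
    (fun _ h => h)
  rintro τ ⟨hL, hle, htop⟩
  refine (runs_scanSigns hL hle htop).seq ?_
  clear hle htop hL τ
  rintro τ ⟨hL, hS⟩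
  refine Runs.seq (M := fun τ' => ∃ b p q, Scanned f b p q ∧
    Prepared f R ε (max p q) (min p q) b τ') (runs_ite (T := 3) (fun hb => ?_) (fun hb => ?_)) ?_
  · have hb' : τ.reg 2 < τ.reg 3 := hb
    exact runs_block _ (by simp [BlockDefined, Instr.Defined]) ⟨_, _, _, hS,
      hL.congr rfl rfl rfl rfl rfl rfl, (max_eq_right hb'.le).symm, (min_eq_left hb'.le).symm, rfl⟩
  · have hb' : τ.reg 3 ≤ τ.reg 2 := not_lt.1 hb
    exact (runs_skip ⟨_, _, _, hS, hL, (max_eq_left hb').symm,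
      (min_eq_right hb').symm, rfl⟩).mono (by omega) (fun _ h => h)
  · rintro τ' ⟨b, p, q, hS, hP⟩
    refine runs_block _ (by simp [BlockDefined, Instr.Defined]) ⟨b, p, q, hS,
      hP.toLoaded.congr rfl rfl rfl rfl rfl rfl, hP.reg_two, hP.reg_three, ?_⟩
    simp [Instr.run, hP.reg_three, hP.reg_four]

/-! ### Evaluation -/

/-- Registers `10` and `11` receive the values of the exponential sum and of its slope sum at the
content of register `5`, both divided by the lowest power; register `12` receives their product. -/
def evaluate (W : Program) : Program :=
  .seq (block [.const 10 0, .const 11 0, .iconst 1 0]) <|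
  .seq (.while (.ilt 1 0) <|
    .seq (block [.load 13 1 1, .sub 13 13 3]) <|
    .seq W <|
    block [.load 12 0 1, .mul 12 12 14, .add 10 10 12, .load 13 1 1, .sub 13 13 2,
      .mul 12 12 13, .add 11 11 12, .isucc 1]) <|
  block [.mul 12 10 11]

/-- The state `τ` results from `σ` by an evaluation at `x`. -/
structure Evaluated (f : ExpSum k) (R ε s m B x : ℝ) (σ τ : State) : Prop extends
    Prepared f R ε s m B τ where
  reg_five : τ.reg 5 = x
  sum : τ.reg 10 = shiftedSum f.coeff f.expo m x
  slope : τ.reg 11 = slopeSum f.coeff f.expo s m x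
  prod : τ.reg 12 = shiftedSum f.coeff f.expo m x * slopeSum f.coeff f.expo s m x
  reg_eq : ∀ r ≤ 9, τ.reg r = σ.reg r
  arr_eq : τ.arr = σ.arr
  idx_eq : ∀ i, i ≠ 1 → τ.idx i = σ.idx i

theorem runs_evaluate {W : Program} {A : ℝ → Prop} {T : ℕ} (hW : ComputesPow W A T)
    (hA : ∀ i, A (f.expo i - m)) {σ : State} {x : ℝ} (hσ : Prepared f R ε s m B σ)
    (hx : σ.reg 5 = x) (hx0 : 0 < x) :
    Runs (evaluate W) σ (k * (T + 11) + 5) (Evaluated f R ε s m B x σ) := by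
  let Fr : State → Prop := fun τ => Prepared f R ε s m B τ ∧ (∀ r ≤ 9, τ.reg r = σ.reg r) ∧
    τ.arr = σ.arr ∧ ∀ i, i ≠ 1 → τ.idx i = σ.idx i
  let I : ℕ → State → Prop := fun n τ => ∃ i, i + n = k ∧ τ.idx 1 = i ∧ Fr τ ∧
    τ.reg 10 = ∑ j ∈ Finset.range i, σ.arr 0 j * x ^ (σ.arr 1 j - m) ∧
    τ.reg 11 = ∑ j ∈ Finset.range i, σ.arr 0 j * (σ.arr 1 j - s) * x ^ (σ.arr 1 j - m)
  refine Runs.mono (Runs.seq (T := 3) (T' := k * (T + 11) + 1 + 1) (M := I k) ?_ ?_) (by omega)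
    (fun _ h => h)
  · refine runs_block _ (by simp [BlockDefined, Instr.Defined]) ⟨0, by omega, rfl,
      ⟨hσ.congr rfl rfl rfl rfl rfl rfl rfl rfl rfl, ?_, rfl, ?_⟩, by simp [Instr.run],
      by simp [Instr.run]⟩
    · intro r hr
      simp [Instr.run, Function.update, show r ≠ 10 by omega, show r ≠ 11 by omega]
    · intro i hi
      simp [Instr.run, Function.update, hi]
  intro τ hτ
  refine Runs.seq (M := I 0) ((runs_while (T := 2 + (T + 8)) (Q := I 0) I ?_ ?_ k τ hτ).mono
    (le_of_eq (by ring)) fun _ h => h) ?_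
  · rintro n τ ⟨i, hi, hi1, ⟨hP, hreg, harr, hidx⟩, h10, h11⟩ hb
    have hik : i < k := by simpa [Test.Holds, hi1, hP.idx_zero] using hb
    refine ⟨n - 1, by omega, ?_⟩
    have ha1 : σ.arr 1 i = f.expo ⟨i, hik⟩ := hσ.expo ⟨i, hik⟩
    refine (runs_block [.load 13 1 1, .sub 13 13 3] (by simp [BlockDefined, Instr.Defined])
      (Q := fun τ' => τ'.idx 1 = i ∧ Fr τ' ∧ τ'.reg 10 = τ.reg 10 ∧ τ'.reg 11 = τ.reg 11 ∧
        τ'.reg 13 = σ.arr 1 i - m) ?_).seq ?_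
    · refine ⟨hi1, ⟨hP.congr rfl rfl rfl rfl rfl rfl rfl rfl rfl, ?_, harr, hidx⟩, rfl, rfl, ?_⟩
      · intro r hr
        simpa [Instr.run, Function.update, show r ≠ 13 by omega] using hreg r hr
      · simp [Instr.run, hi1, harr, hP.reg_three]
    rintro τ₁ ⟨hi1', ⟨hP', hreg', harr', hidx'⟩, h10', h11', h13'⟩
    have h5' : τ₁.reg 5 = x := by rw [hreg' 5 (by omega), hx]
    refine (hW τ₁ (by rw [h5']; exact hx0) (by rw [h13', ha1]; exact hA _)).seq ?_
    rintro τ₂ ⟨h14, hr2, ha2, hi2⟩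
    rw [h5', h13'] at h14
    have hP2 : Prepared f R ε s m B τ₂ := hP'.congr (by rw [hi2]) (by rw [ha2]) (by rw [ha2])
      (hr2 _ (by omega)) (hr2 _ (by omega)) (hr2 _ (by omega)) (hr2 _ (by omega))
      (hr2 _ (by omega)) (hr2 _ (by omega))
    have hidx2 : τ₂.idx 1 = i := by rw [hi2, hi1']
    have harr2 : τ₂.arr = σ.arr := ha2.trans harr'
    refine runs_block _ (by simp [BlockDefined, Instr.Defined]) ⟨i + 1, by omega, ?_,
      ⟨hP2.congr rfl rfl rfl rfl rfl rfl rfl rfl rfl, ?_, harr2, ?_⟩, ?_, ?_⟩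
    · simp [Instr.run, hidx2]
    · intro r hr
      simpa [Instr.run, Function.update, show r ≠ 10 by omega, show r ≠ 11 by omega,
        show r ≠ 12 by omega, show r ≠ 13 by omega]
        using (hr2 r (by omega)).trans (hreg' r hr)
    · intro j hj
      simpa [Instr.run, Function.update, hj, hi2] using hidx' j hj
    · rw [Finset.sum_range_succ, ← h10, ← h10', ← hr2 10 (by omega)]
      simp [Instr.run, hidx2, harr2, h14]
    · rw [Finset.sum_range_succ, ← h11, ← h11', ← hr2 11 (by omega)]
      simp [Instr.run, hidx2, harr2, h14, hP2.reg_two]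
      ring
  · rintro n τ ⟨i, hi, hi1, hF, hrest⟩ hb
    have hik : ¬ i < k := by simpa [Test.Holds, hi1, hF.1.idx_zero] using hb
    exact ⟨i, by omega, hi1, hF, hrest⟩
  · rintro τ ⟨i, hi, hi1, ⟨hP, hreg, harr, hidx⟩, h10, h11⟩
    obtain rfl : i = k := by omega
    have h10' : τ.reg 10 = shiftedSum f.coeff f.expo m x := by
      rw [h10, ← Fin.sum_univ_eq_sum_range (fun j => σ.arr 0 j * x ^ (σ.arr 1 j - m))]
      simp only [shiftedSum, hσ.coeff, hσ.expo]
    have h11' : τ.reg 11 = slopeSum f.coeff f.expo s m x := by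
      rw [h11, ← Fin.sum_univ_eq_sum_range
        (fun j => σ.arr 0 j * (σ.arr 1 j - s) * x ^ (σ.arr 1 j - m))]
      simp only [slopeSum, hσ.coeff, hσ.expo]
    refine runs_block _ (by simp [BlockDefined, Instr.Defined])
      ⟨hP.congr rfl rfl rfl rfl rfl rfl rfl rfl rfl, ?_, h10', h11', ?_, ?_, harr, hidx⟩
    · exact (hreg 5 (by omega)).trans hx
    · simp [Instr.run, h10', h11']
    · intro r hr
      simpa [Instr.run, Function.update, show r ≠ 12 by omega] using hreg r hr

end RealRAM

namespace RealRAM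

open ExpSum

variable {k : ℕ} {f : ExpSum k} {R ε s m B : ℝ}

/-! ### Locating the root -/

/-- Array `2` receives the numbers `2 ^ 2 ^ i` up to the first one for which
`ε * 2 ^ 2 ^ i ≥ R`, and index register `2` their number. -/
def climb : Program :=
  .seq (block [.const 7 2, .copy 6 1, .iconst 2 0, .mul 8 6 7]) <|
  .while (.lt 8 0) <|
    block [.store 2 2 7, .isucc 2, .mul 7 7 7, .mul 8 6 7]

/-- The content `y` of register `6` grows, staying below the root `ρ`, until `ρ < 2 * y`. -/
def descend (W : Program) : Program :=
  .seq (block [.iconst 3 0]) <|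
  .while (.ilt 3 2) <|
    .seq (block [.ipred 2, .load 7 2 2, .mul 5 6 7]) <|
    .seq (evaluate W) <|
    .ite (.lt 9 12) .skip (.instr (.copy 6 5))

/-- The interval from `y` (register `6`) to `y + w` (`w` in register `7`) is halved until it is
short enough for Newton's method. -/
def bisect (W : Program) : Program :=
  .seq (block [.copy 7 6, .mul 8 7 4]) <|
  .while (.lt 6 8) <|
    .seq (block [.const 12 (1 / 2), .mul 7 7 12, .add 5 6 7]) <|
    .seq (evaluate W) <|
    .seq (.ite (.lt 9 12) .skip (.instr (.copy 6 5))) <|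
    .instr (.mul 8 7 4)

/-- Newton's method for the approximation in register `6`. Register `7` bounds the quality of the
approximation and is squared in every step. -/
def newtonLoop (W : Program) : Program :=
  .seq (block [.const 7 (1 / 2), .mul 8 7 0]) <|
  .while (.lt 1 8) <|
    .seq (.instr (.copy 5 6)) <|
    .seq (evaluate W) <|
    block [.div 12 10 11, .mul 12 5 12, .sub 6 5 12, .mul 7 7 7, .mul 8 7 0]

theorem runs_climb {N : ℕ} (hN : R ≤ ε * 2 ^ 2 ^ N) {σ : State} (hσ : Prepared f R ε s m B σ) :
    Runs climb σ (5 * N + 5) fun τ => Prepared f R ε s m B τ ∧ τ.reg 6 = ε ∧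
      ∃ i ≤ N, τ.idx 2 = i ∧ R ≤ ε * 2 ^ 2 ^ i ∧ ∀ j < i, τ.arr 2 j = 2 ^ 2 ^ j := by
  let I : ℕ → State → Prop := fun n τ => ∃ i, i + n = N ∧ Prepared f R ε s m B τ ∧
    τ.reg 6 = ε ∧ τ.reg 7 = 2 ^ 2 ^ i ∧ τ.reg 8 = ε * 2 ^ 2 ^ i ∧ τ.idx 2 = i ∧
    ∀ j < i, τ.arr 2 j = 2 ^ 2 ^ j
  refine Runs.mono (Runs.seq (T := 4) (T' := N * 5 + 1) (M := I N) ?_ fun τ hτ =>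
    runs_while (T := 4) I ?_ ?_ N τ hτ) (by omega) (fun _ h => h)
  · refine runs_block _ (by simp [BlockDefined, Instr.Defined]) ⟨0, by omega,
      hσ.congr rfl rfl rfl rfl rfl rfl rfl rfl rfl, ?_, ?_, ?_, rfl, by simp⟩ <;>
    simp [Instr.run, hσ.reg_one]
  · rintro n τ ⟨i, hi, hP, h6, h7, h8, hi2, harr⟩ hb
    have hlt : ε * 2 ^ 2 ^ i < R := by rw [← h8, ← hP.reg_zero]; exact hb
    have hiN : i ≠ N := by rintro rfl; exact hN.not_gt hlt
    have hsq : (2 : ℝ) ^ 2 ^ i * 2 ^ 2 ^ i = 2 ^ 2 ^ (i + 1) := by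
      rw [← pow_add]; congr 1; ring
    refine ⟨n - 1, by omega, runs_block _ (by simp [BlockDefined, Instr.Defined])
      ⟨i + 1, by omega, hP.congr rfl rfl rfl rfl rfl rfl rfl rfl rfl, h6, ?_, ?_, ?_, ?_⟩⟩
    · simp [Instr.run, h7, hsq]
    · simp [Instr.run, h7, hsq, h6]
    · simp [Instr.run, hi2]
    · intro j hj
      rcases Nat.lt_succ_iff_lt_or_eq.1 hj with h | rfl
      · simpa [Instr.run, Function.update, hi2, h.ne] using harr j h
      · simp [Instr.run, hi2, h7]
  · rintro n τ ⟨i, hi, hP, h6, h7, h8, hi2, harr⟩ hb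
    have hle : R ≤ ε * 2 ^ 2 ^ i := by rw [← h8, ← hP.reg_zero]; exact not_lt.1 hb
    exact ⟨hP, h6, i, by omega, hi2, hle, harr⟩

variable {W : Program} {A : ℝ → Prop} {T : ℕ} {ρ : ℝ}

theorem runs_descend (hW : ComputesPow W A T) (hA : ∀ i, A (f.expo i - m)) (hs : f.Separates s)
    (hρ : 0 < ρ) (h0 : f.eval ρ = 0) (hε : 0 < ε) (hερ : ε ≤ ρ) {i : ℕ}
    (hρi : ρ < ε * 2 ^ 2 ^ i) {σ : State} (hσ : Prepared f R ε s m B σ) (h6 : σ.reg 6 = ε)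
    (hi : σ.idx 2 = i) (harr : ∀ j < i, σ.arr 2 j = 2 ^ 2 ^ j) :
    Runs (descend W) σ (i * (k * (T + 11) + 11) + 2) fun τ => Prepared f R ε s m B τ ∧
      0 < τ.reg 6 ∧ τ.reg 6 ≤ ρ ∧ ρ < τ.reg 6 * 2 := by
  let I : ℕ → State → Prop := fun n τ => Prepared f R ε s m B τ ∧ 0 < τ.reg 6 ∧
    τ.reg 6 ≤ ρ ∧ ρ < τ.reg 6 * 2 ^ 2 ^ n ∧ τ.idx 2 = n ∧ τ.idx 3 = 0 ∧
    ∀ j < n, τ.arr 2 j = 2 ^ 2 ^ j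
  refine Runs.mono (Runs.seq (T := 1) (T' := i * (3 + (k * (T + 11) + 5 + 2) + 1) + 1) (M := I i)
    ?_ fun τ hτ => runs_while (T := 3 + (k * (T + 11) + 5 + 2)) I ?_ ?_ i τ hτ)
    (le_of_eq (by ring)) (fun _ h => h)
  · refine runs_block _ (by simp [BlockDefined, Instr.Defined])
      ⟨hσ.congr rfl rfl rfl rfl rfl rfl rfl rfl rfl, ?_⟩
    simpa [Instr.run, h6, hi] using ⟨hε, hερ, hρi, harr⟩
  · rintro n τ ⟨hP, hpos, hle, hlt, hi2, hi3, harr⟩ hb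
    have hn : 0 < n := by simpa [Test.Holds, hi2, hi3] using hb
    obtain ⟨n, rfl⟩ : ∃ n', n = n' + 1 := ⟨n - 1, by omega⟩
    refine ⟨n, rfl, ?_⟩
    refine (runs_block [.ipred 2, .load 7 2 2, .mul 5 6 7] (by simp [BlockDefined, Instr.Defined])
      (Q := fun τ' => Prepared f R ε s m B τ' ∧ τ'.reg 6 = τ.reg 6 ∧
        τ'.reg 5 = τ.reg 6 * 2 ^ 2 ^ n ∧ τ'.idx 2 = n ∧ τ'.idx 3 = 0 ∧ τ'.arr = τ.arr) ?_).seq ?_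
    · refine ⟨hP.congr rfl rfl rfl rfl rfl rfl rfl rfl rfl, rfl, ?_, ?_, hi3, rfl⟩ <;>
        simp [Instr.run, hi2, harr]
    rintro τ₁ ⟨hP1, h6, h5, hi2', hi3', ha1⟩
    have hx0 : 0 < τ.reg 6 * 2 ^ 2 ^ n := by positivity
    refine (runs_evaluate hW hA hP1 h5 hx0).seq fun τ₂ hE => ?_
    have htest : (Test.lt 9 12).Holds τ₂ ↔ ρ < τ.reg 6 * 2 ^ 2 ^ n := by
      rw [Test.Holds, hE.reg_nine, hE.prod, hs.pos_iff m hx0 hρ h0]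
    have h6' : τ₂.reg 6 = τ.reg 6 := (hE.reg_eq 6 (by omega)).trans h6
    have harr2 : ∀ j < n, τ₂.arr 2 j = 2 ^ 2 ^ j := by
      intro j hj
      rw [hE.arr_eq, ha1, harr j (by omega)]
    have hi22 := (hE.idx_eq 2 (by omega)).trans hi2'
    have hi33 := (hE.idx_eq 3 (by omega)).trans hi3'
    refine runs_ite (T := 1) (fun hb => ?_) (fun hb => ?_)
    · exact (runs_skip ⟨hE.toPrepared, by rwa [h6'], by rwa [h6'], by rw [h6']; exact htest.1 hb,
        hi22, hi33, harr2⟩).mono (by omega) (fun _ h => h)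
    · have hle' := not_lt.1 (fun h => hb (htest.2 h))
      refine runs_instr trivial ⟨hE.toPrepared.congr rfl rfl rfl rfl rfl rfl rfl rfl rfl, ?_, ?_,
        ?_, hi22, hi33, harr2⟩ <;> simp only [Instr.run, Function.update_self, hE.reg_five]
      · exact hx0
      · exact hle'
      · rw [mul_assoc, ← pow_add]
        convert hlt using 3
        ring
  · rintro n τ ⟨hP, hpos, hle, hlt, hi2, hi3, -⟩ hb
    obtain rfl : n = 0 := by simpa [Test.Holds, hi2, hi3] using hb
    exact ⟨hP, hpos, hle, by simpa using hlt⟩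

theorem runs_bisect (hW : ComputesPow W A T) (hA : ∀ i, A (f.expo i - m)) (hs : f.Separates s)
    (h0 : f.eval ρ = 0) {N : ℕ} (hN : B ≤ 2 ^ N) {σ : State}
    (hσ : Prepared f R ε s m B σ) (hpos : 0 < σ.reg 6) (hle : σ.reg 6 ≤ ρ)
    (hlt : ρ < σ.reg 6 * 2) :
    Runs (bisect W) σ (N * (k * (T + 11) + 12) + 3) fun τ => Prepared f R ε s m B τ ∧
      0 < τ.reg 6 ∧ τ.reg 6 ≤ ρ ∧ (ρ - τ.reg 6) * B ≤ τ.reg 6 := by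
  have hρ : 0 < ρ := hpos.trans_le hle
  let I : ℕ → State → Prop := fun n τ => Prepared f R ε s m B τ ∧ 0 < τ.reg 6 ∧
    τ.reg 6 ≤ ρ ∧ ρ < τ.reg 6 + τ.reg 7 ∧ 0 < τ.reg 7 ∧ τ.reg 8 = τ.reg 7 * B ∧
    τ.reg 7 * B ≤ τ.reg 6 * 2 ^ n
  refine Runs.mono (Runs.seq (T := 2) (T' := N * (3 + (k * (T + 11) + 5 + (2 + 1)) + 1) + 1)
    (M := I N) ?_ fun τ hτ => runs_while (T := 3 + (k * (T + 11) + 5 + (2 + 1))) I ?_ ?_ N τ hτ)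
    (le_of_eq (by ring)) (fun _ h => h)
  · refine runs_block _ (by simp [BlockDefined, Instr.Defined])
      ⟨hσ.congr rfl rfl rfl rfl rfl rfl rfl rfl rfl, hpos, hle, ?_, hpos, ?_, ?_⟩
    · simp [Instr.run]; linarith
    · simp [Instr.run, hσ.reg_four]
    · simpa [Instr.run] using mul_le_mul_of_nonneg_left hN hpos.le
  · rintro n τ ⟨hP, hpos, hle, hlt, hw, h8, hn⟩ hb
    have hb' : τ.reg 6 < τ.reg 7 * B := by rw [← h8]; exact hb
    obtain _ | n := n
    · rw [pow_zero, mul_one] at hn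
      exact absurd hb' hn.not_gt
    refine ⟨n, rfl, ?_⟩
    refine (runs_block [.const 12 (1 / 2), .mul 7 7 12, .add 5 6 7]
      (by simp [BlockDefined, Instr.Defined])
      (Q := fun τ' => Prepared f R ε s m B τ' ∧ τ'.reg 6 = τ.reg 6 ∧ τ'.reg 7 = τ.reg 7 / 2 ∧
        τ'.reg 5 = τ.reg 6 + τ.reg 7 / 2) ?_).seq ?_
    · exact ⟨hP.congr rfl rfl rfl rfl rfl rfl rfl rfl rfl, rfl, by simp [Instr.run]; ring,
        by simp [Instr.run]; ring⟩
    rintro τ₁ ⟨hP1, h6, h7, h5⟩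
    have hx0 : 0 < τ.reg 6 + τ.reg 7 / 2 := by positivity
    refine (runs_evaluate hW hA hP1 h5 hx0).seq fun τ₂ hE => ?_
    have htest : (Test.lt 9 12).Holds τ₂ ↔ ρ < τ.reg 6 + τ.reg 7 / 2 := by
      rw [Test.Holds, hE.reg_nine, hE.prod, hs.pos_iff m hx0 hρ h0]
    have h6' : τ₂.reg 6 = τ.reg 6 := (hE.reg_eq 6 (by omega)).trans h6
    have h7' : τ₂.reg 7 = τ.reg 7 / 2 := (hE.reg_eq 7 (by omega)).trans h7
    rw [pow_succ] at hn
    have hB : 0 < 2 ^ n * τ.reg 7 := by positivity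
    refine Runs.seq (M := fun τ' => Prepared f R ε s m B τ' ∧ 0 < τ'.reg 6 ∧
      τ'.reg 6 ≤ ρ ∧ ρ < τ'.reg 6 + τ'.reg 7 ∧ 0 < τ'.reg 7 ∧
      τ'.reg 7 * B ≤ τ'.reg 6 * 2 ^ n) (runs_ite (T := 1) (fun hb => ?_) (fun hb => ?_)) ?_
    · refine (runs_skip ⟨hE.toPrepared, ?_⟩).mono (by omega) (fun _ h => h)
      rw [h6', h7']
      exact ⟨hpos, hle, htest.1 hb, by positivity, by linarith⟩
    · have hle' := not_lt.1 (fun h => hb (htest.2 h))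
      refine runs_instr trivial ⟨hE.toPrepared.congr rfl rfl rfl rfl rfl rfl rfl rfl rfl, ?_⟩
      have e6 : (Instr.run τ₂ (.copy 6 5)).reg 6 = τ.reg 6 + τ.reg 7 / 2 := by
        simp [Instr.run, hE.reg_five]
      have e7 : (Instr.run τ₂ (.copy 6 5)).reg 7 = τ.reg 7 / 2 := by
        simp [Instr.run, h7']
      rw [e6, e7]
      exact ⟨hx0, hle', by linarith, by positivity, by nlinarith⟩
    · rintro τ₃ ⟨hP3, h1, h2, h3, h4, h5⟩
      exact runs_instr trivial ⟨hP3.congr rfl rfl rfl rfl rfl rfl rfl rfl rfl, h1, h2, h3, h4,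
        by simp [Instr.run, hP3.reg_four], h5⟩
  · rintro n τ ⟨hP, hpos, hle, hlt, hw, h8, hn⟩ hb
    have hb' : τ.reg 7 * B ≤ τ.reg 6 := by rw [← h8]; exact not_lt.1 hb
    refine ⟨hP, hpos, hle, ?_⟩
    rcases le_or_gt B 0 with hB | hB
    · exact (mul_nonpos_of_nonneg_of_nonpos (by linarith) hB).trans hpos.le
    · exact le_trans (mul_le_mul_of_nonneg_right (by linarith) hB.le) hb'

/-- The invariant of the iteration: the relative error, multiplied by eight times the bound `K`, is
at most `q`, and `q` gets squared. -/
theorem newton_step (hs : f.Separates s) {K : ℝ} (hK : ∀ i, |f.expo i - s| + 1 ≤ K)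
    (hρ : 0 < ρ) (h0 : f.eval ρ = 0) {x q : ℝ} (hK1 : 1 ≤ K) (hx : 0 < x) (hq : q ≤ 1 / 2)
    (hxq : |x - ρ| * (8 * K) ≤ ρ * q) :
    |x - x * (shiftedSum f.coeff f.expo m x / slopeSum f.coeff f.expo s m x) - ρ| * (8 * K) ≤
      ρ * (q * q) := by
  have hK8 : 8 * |x - ρ| ≤ |x - ρ| * (8 * K) := by nlinarith [abs_nonneg (x - ρ)]
  have hρq : ρ * q ≤ ρ * (1 / 2) := mul_le_mul_of_nonneg_left hq hρ.le
  have hxρ : ρ / 2 ≤ x := by linarith [neg_abs_le (x - ρ)]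
  have h1 := hs.newton m hK hx hρ h0 (by linarith)
  have h2 : 4 * K * (x - ρ) ^ 2 / x ≤ 4 * K * (x - ρ) ^ 2 / (ρ / 2) :=
    div_le_div_of_nonneg_left (by positivity) (by positivity) hxρ
  calc _ ≤ 4 * K * (x - ρ) ^ 2 / (ρ / 2) * (8 * K) :=
        mul_le_mul_of_nonneg_right (h1.trans h2) (by positivity)
    _ = (|x - ρ| * (8 * K)) ^ 2 / ρ := by rw [mul_pow, sq_abs]; field_simp; ring
    _ ≤ (ρ * q) ^ 2 / ρ :=
        div_le_div_of_nonneg_right (pow_le_pow_left₀ (by positivity) hxq 2) hρ.le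
    _ = ρ * (q * q) := by field_simp

theorem runs_newtonLoop (hW : ComputesPow W A T) (hA : ∀ i, A (f.expo i - m)) (hs : f.Separates s)
    (h0 : f.eval ρ = 0) (hρR : ρ < R) {K : ℝ} (hK : ∀ i, |f.expo i - s| + 1 ≤ K) (hK1 : 1 ≤ K)
    {N : ℕ} (hN : R ≤ ε * 2 ^ 2 ^ N) {σ : State} (hσ : Prepared f R ε s m B σ)
    (hpos : 0 < σ.reg 6) (hle : σ.reg 6 ≤ ρ) (hclose : (ρ - σ.reg 6) * (K * 16) ≤ σ.reg 6) :
    Runs (newtonLoop W) σ (N * (k * (T + 11) + 12) + 3) fun τ => |τ.reg 6 - ρ| ≤ ε := by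
  have hρ : 0 < ρ := hpos.trans_le hle
  let I : ℕ → State → Prop := fun n τ => ∃ i, i + n = N ∧ Prepared f R ε s m B τ ∧
    0 < τ.reg 6 ∧ τ.reg 7 = (1 / 2) ^ 2 ^ i ∧ τ.reg 8 = τ.reg 7 * R ∧
    |τ.reg 6 - ρ| * (8 * K) ≤ ρ * τ.reg 7
  have hhalf : ∀ i, (1 / 2 : ℝ) ^ 2 ^ i ≤ 1 / 2 := fun i => by
    simpa using pow_le_pow_of_le_one (by norm_num : (0 : ℝ) ≤ 1 / 2) (by norm_num)
      (Nat.one_le_two_pow (n := i))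
  refine Runs.mono (Runs.seq (T := 2) (T' := N * (1 + (k * (T + 11) + 5 + 5) + 1) + 1)
    (M := I N) ?_ fun τ hτ => runs_while (T := 1 + (k * (T + 11) + 5 + 5)) I ?_ ?_ N τ hτ)
    (le_of_eq (by ring)) (fun _ h => h)
  · refine runs_block _ (by simp [BlockDefined, Instr.Defined])
      ⟨0, by omega, hσ.congr rfl rfl rfl rfl rfl rfl rfl rfl rfl, hpos, by simp [Instr.run],
        by simp [Instr.run, hσ.reg_zero], ?_⟩
    change |σ.reg 6 - ρ| * (8 * K) ≤ ρ * ((1 / 2 : ℚ) : ℝ)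
    push_cast
    rw [abs_sub_comm, abs_of_nonneg (sub_nonneg.2 hle)]
    linarith
  · rintro n τ ⟨i, hi, hP, hpos, h7, h8, hxq⟩ hb
    have hb' : ε < τ.reg 7 * R := by rw [← h8, ← hP.reg_one]; exact hb
    have hiN : i ≠ N := by
      rintro rfl
      rw [h7, one_div, inv_pow, inv_mul_eq_div, lt_div_iff₀ (by positivity)] at hb'
      exact hN.not_gt hb'
    refine ⟨n - 1, by omega, ?_⟩
    refine (runs_instr (I := .copy 5 6) trivial (Q := fun τ' => Prepared f R ε s m B τ' ∧
      τ'.reg 5 = τ.reg 6 ∧ τ'.reg 7 = τ.reg 7)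
      ⟨hP.congr rfl rfl rfl rfl rfl rfl rfl rfl rfl, rfl, rfl⟩).seq ?_
    rintro τ₁ ⟨hP1, h5, h7'⟩
    refine (runs_evaluate hW hA hP1 h5 hpos).seq fun τ₂ hE => ?_
    have h7'' : τ₂.reg 7 = τ.reg 7 := (hE.reg_eq 7 (by omega)).trans h7'
    have hq : τ.reg 7 ≤ 1 / 2 := h7 ▸ hhalf i
    have hq0 : 0 < τ.reg 7 := by rw [h7]; positivity
    have hstep := newton_step (m := m) hs hK hρ h0 hK1 hpos hq hxq
    have hne : τ₂.reg 11 ≠ 0 := by rw [hE.slope]; exact hs.slopeSum_ne_zero m hpos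
    refine runs_block _ (by simp [BlockDefined, Instr.Defined, hne]) ?_
    refine ⟨i + 1, by omega, hE.toPrepared.congr rfl rfl rfl rfl rfl rfl rfl rfl rfl, ?_, ?_, ?_, ?_⟩
    · change 0 < τ₂.reg 5 - τ₂.reg 5 * (τ₂.reg 10 / τ₂.reg 11)
      rw [hE.reg_five, hE.sum, hE.slope]
      set x' := τ.reg 6 - τ.reg 6 * (shiftedSum f.coeff f.expo m (τ.reg 6) /
        slopeSum f.coeff f.expo s m (τ.reg 6)) with hx'
      have h1 : |x' - ρ| * 8 ≤ |x' - ρ| * (8 * K) :=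
        mul_le_mul_of_nonneg_left (by linarith) (abs_nonneg _)
      have h2 : ρ * (τ.reg 7 * τ.reg 7) ≤ ρ * (1 / 2 * (1 / 2)) :=
        mul_le_mul_of_nonneg_left (mul_le_mul hq hq hq0.le (by norm_num)) hρ.le
      linarith [neg_abs_le (x' - ρ)]
    · simp [Instr.run, h7'', h7]
      rw [← mul_inv, ← pow_add]; congr 2; ring
    · simp [Instr.run, hE.reg_zero]
    · simpa [Instr.run, hE.reg_five, hE.sum, hE.slope, h7''] using hstep
  · rintro n τ ⟨i, hi, hP, hpos, h7, h8, hxq⟩ hb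
    have hb' : τ.reg 7 * R ≤ ε := by rw [← h8, ← hP.reg_one]; exact not_lt.1 hb
    have hq0 : 0 < τ.reg 7 := by rw [h7]; positivity
    nlinarith [abs_nonneg (τ.reg 6 - ρ)]

/-! ### The whole algorithm -/

/-- Given that there is a root in `(0, R)`, register `6` receives an approximation of it. If the
root is below `ε`, this is `ε` itself. -/
def locate (W : Program) : Program :=
  .seq (.instr (.copy 5 1)) <|
  .seq (evaluate W) <|
  .ite (.lt 9 12) (.instr (.copy 6 5)) <|
  .seq climb <| .seq (descend W) <| .seq (bisect W) (newtonLoop W)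

/-- The algorithm, with a subprogram `W` that computes powers. -/
def solver (W : Program) : Program :=
  .seq prepare <|
  .seq (.instr (.copy 5 0)) <|
  .seq (evaluate W) <|
  .ite (.lt 9 12) (.seq (locate W) (block [.iconst 1 0, .store 0 1 6, .iconst 0 1]))
    (.instr (.iconst 0 0))

theorem runs_locate (hW : ComputesPow W A T) (hA : ∀ i, A (f.expo i - m)) (hs : f.Separates s)
    (hε : 0 < ε) (hρ : 0 < ρ) (h0 : f.eval ρ = 0) (hρR : ρ < R) {K : ℝ}
    (hK : ∀ i, |f.expo i - s| + 1 ≤ K) (hK1 : 1 ≤ K) {N N' : ℕ} (hN : R ≤ ε * 2 ^ 2 ^ N)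
    (hN' : K * 16 ≤ 2 ^ N') {σ : State} (hσ : Prepared f R ε s m (K * 16) σ) :
    Runs (locate W) σ ((2 * N + N' + 1) * (k * (T + 11) + 20)) fun τ => |τ.reg 6 - ρ| ≤ ε := by
  have htime : 1 + (k * (T + 11) + 5 + ((5 * N + 5 + (N * (k * (T + 11) + 11) + 2 +
      (N' * (k * (T + 11) + 12) + 3 + (N * (k * (T + 11) + 12) + 3)))) + 1)) ≤
      (2 * N + N' + 1) * (k * (T + 11) + 20) := by
    nlinarith
  refine Runs.mono ((runs_instr (I := .copy 5 1) trivial (Q := fun τ =>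
    Prepared f R ε s m (K * 16) τ ∧ τ.reg 5 = ε)
    ⟨hσ.congr rfl rfl rfl rfl rfl rfl rfl rfl rfl, hσ.reg_one⟩).seq ?_) htime (fun _ h => h)
  rintro τ ⟨hP, h5⟩
  refine (runs_evaluate hW hA hP h5 hε).seq fun τ₁ hE => ?_
  have htest : (Test.lt 9 12).Holds τ₁ ↔ ρ < ε := by
    rw [Test.Holds, hE.reg_nine, hE.prod, hs.pos_iff m hε hρ h0]
  refine runs_ite (fun hb => ?_) (fun hb => ?_)
  · refine (runs_instr (I := .copy 6 5) (Q := fun τ => |τ.reg 6 - ρ| ≤ ε) trivial ?_).mono (by omega)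
      (fun _ h => h)
    have := htest.1 hb
    simp only [Instr.run, Function.update_self, hE.reg_five]
    rw [abs_of_nonneg (by linarith)]
    linarith
  · have hερ : ε ≤ ρ := not_lt.1 (fun h => hb (htest.2 h))
    refine (runs_climb hN hE.toPrepared).seq ?_
    rintro τ₂ ⟨hP2, h6, i, hiN, hi2, hRi, harr⟩
    refine ((runs_descend hW hA hs hρ h0 hε hερ (hρR.trans_le hRi) hP2 h6 hi2 harr).mono
      (Nat.add_le_add_right (Nat.mul_le_mul_right _ hiN) _) (fun _ h => h)).seq ?_
    rintro τ₃ ⟨hP3, hpos, hle, hlt⟩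
    refine (runs_bisect hW hA hs h0 hN' hP3 hpos hle hlt).seq ?_
    rintro τ₄ ⟨hP4, hpos, hle, hclose⟩
    exact runs_newtonLoop hW hA hs h0 hρR hK hK1 hN hP4 hpos hle hclose

theorem solves_of_rootsIn_eq_empty {σ : State} (h : f.rootsIn R = ∅) (hσ : σ.idx 0 = 0) :
    Solves f R ε σ := by
  have : IsEmpty (Fin (σ.idx 0)) := by rw [hσ]; infer_instance
  exact ⟨fun i => this.elim i, fun i => this.elim i, by rw [h, Set.range_eq_empty],
    fun i => this.elim i⟩

theorem solves_of_rootsIn_eq_singleton {σ : State} (h : f.rootsIn R = {ρ}) (hσ : σ.idx 0 = 1)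
    (hz : |σ.arr 0 0 - ρ| ≤ ε) : Solves f R ε σ := by
  have hzero : ∀ i : Fin (σ.idx 0), (i : ℕ) = 0 := fun i => by
    have := i.2
    omega
  have : Nonempty (Fin (σ.idx 0)) := by rw [hσ]; infer_instance
  exact ⟨fun _ => ρ, fun i j _ => Fin.ext ((hzero i).trans (hzero j).symm),
    by rw [h, Set.range_const], fun i => by rw [hzero i]; exact hz⟩

theorem runs_solver (hk : 1 ≤ k) (hf : f.signAlternations ≤ 1) (hR : 0 < R) (hε : 0 < ε)
    (hW : ComputesPow W A T) (hA : ∀ i j, f.expo j ≤ f.expo i → A (f.expo i - f.expo j))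
    {N N' : ℕ} (hN : R ≤ ε * 2 ^ 2 ^ N)
    (hN' : ∀ i j, (f.expo i - f.expo j + 1) * 16 ≤ 2 ^ N') :
    Runs (solver W) (input f R ε) (k * (T + 1) * (100 * (N + N' + 1))) (Solves f R ε) := by
  have htime : 12 * k + 16 + (1 + (k * (T + 11) + 5 + (((2 * N + N' + 1) * (k * (T + 11) + 20) +
      3) + 1))) ≤ k * (T + 1) * (100 * (N + N' + 1)) := by
    have h1 : k * (T + 11) + 20 ≤ 32 * (k * (T + 1)) := by nlinarith
    have h2 : k ≤ k * (T + 1) := Nat.le_mul_of_pos_right _ (by omega)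
    have h3 : 2 * N + N' + 1 ≤ 2 * (N + N') + 1 := by omega
    calc _ ≤ 36 * k + 32 * (k * (T + 1)) +
          (2 * (N + N') + 1) * (32 * (k * (T + 1))) := by
          have := Nat.mul_le_mul h3 h1
          omega
      _ ≤ _ := by nlinarith
  refine Runs.mono ((runs_prepare hk (loaded_input f R ε)).seq ?_) htime (fun _ h => h)
  rintro τ ⟨b, p, q, hS, hP⟩
  obtain ⟨i₀, hi₀⟩ := hS.exists_eq_min
  obtain ⟨i₁, hi₁⟩ := hS.exists_eq_max
  obtain ⟨i₂, hi₂⟩ := hS.top_mem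
  have hA' : ∀ i, A (f.expo i - min p q) := fun i => by
    rw [← hi₀]; exact hA i i₀ (by rw [hi₀]; exact hS.min_le i)
  refine (runs_instr (I := .copy 5 0) trivial (Q := fun τ => Prepared f R ε (max p q) (min p q)
    ((b - min p q + 1) * 16) τ ∧ τ.reg 5 = R)
    ⟨hP.congr rfl rfl rfl rfl rfl rfl rfl rfl rfl, hP.reg_zero⟩).seq ?_
  rintro τ₁ ⟨hP1, h5⟩
  refine (runs_evaluate hW hA' hP1 h5 hR).seq fun τ₂ hE => ?_
  have htest : (Test.lt 9 12).Holds τ₂ ↔ 0 < shiftedSum f.coeff f.expo (min p q) R *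
      slopeSum f.coeff f.expo (max p q) (min p q) R := by
    rw [Test.Holds, hE.reg_nine, hE.prod]
  refine runs_ite (fun hb => ?_) (fun hb => ?_)
  · have hprod := htest.1 hb
    have hsep : f.Separates (max p q) := (hS.separates_or hf).resolve_right fun h =>
      ((h R hR).2 _).not_gt hprod
    obtain ⟨ρ, hρ, hρR, h0⟩ := hsep.exists_root _ hR hprod
    have hroots : f.rootsIn R = {ρ} := by
      refine Set.eq_singleton_iff_unique_mem.2 ⟨⟨hρ, hρR, h0⟩, ?_⟩
      rintro y ⟨hy, -, hy0⟩
      -- neither root is below the other one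
      have h1 := hsep.pos_iff 0 hy hρ h0
      have h2 := hsep.pos_iff 0 hy hy hy0
      have h3 := hsep.pos_iff 0 hρ hy hy0
      have h4 := hsep.pos_iff 0 hρ hρ h0
      exact le_antisymm (not_lt.1 fun h => lt_irrefl _ (h2.1 (h1.2 h)))
        (not_lt.1 fun h => lt_irrefl _ (h4.1 (h3.2 h)))
    have hK : ∀ i, |f.expo i - max p q| + 1 ≤ b - min p q + 1 := by
      intro i
      have h1 := hS.min_le i
      have h2 := hS.le_top i
      have h3 := hS.min_le i₁
      have h4 := hS.le_top i₁
      rw [hi₁] at h3 h4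
      rw [add_le_add_iff_right, abs_le]
      constructor <;> linarith
    have hK1 : 1 ≤ b - min p q + 1 := by
      have := hS.le_top i₀
      linarith
    refine (runs_locate hW hA' hsep hε hρ h0 hρR hK hK1 hN ?_ hE.toPrepared).seq fun τ₃ h => ?_
    · rw [← hi₀, ← hi₂]
      exact hN' _ _
    · refine runs_block _ (by simp [BlockDefined, Instr.Defined])
        (solves_of_rootsIn_eq_singleton hroots rfl ?_)
      simpa [Instr.run] using h
  · refine (runs_instr (I := .iconst 0 0) trivial
      (solves_of_rootsIn_eq_empty (f := f) (R := R) ?_ rfl)).mono (by omega) (fun _ h => h)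
    refine Set.eq_empty_of_forall_notMem ?_
    rintro y ⟨hy, hyR, hy0⟩
    rcases hS.separates_or hf with h | h
    · exact hb (htest.2 ((h.pos_iff _ hR hy hy0).2 hyR))
    · exact (h y hy).1 hy0

/-! ### The number of steps -/

theorem exists_pow_pow_ge (hε : 0 < ε) :
    ∃ N : ℕ, R ≤ ε * 2 ^ 2 ^ N ∧ (N : ℝ) ≤ 2 + 2 * log⁺ (log⁺ (R / ε)) := by
  set t := log⁺ (R / ε) with ht
  set y := log⁺ t with hy
  have hy0 : 0 ≤ y := posLog_nonneg
  have ht0 : 0 ≤ t := posLog_nonneg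
  have hln2 : 1 / 2 ≤ log 2 := by linarith [log_two_gt_d9]
  have hexp : ∀ u : ℝ, u ≤ exp (log⁺ u) := fun u => by
    rcases le_or_gt u 0 with h | h
    · exact h.trans (exp_pos _).le
    · calc u = exp (log u) := (exp_log h).symm
        _ ≤ _ := exp_le_exp.2 (by rw [posLog_apply]; exact le_max_right _ _)
  have hpow : ∀ n : ℕ, exp (n / 2) ≤ 2 ^ n := fun n => by
    rw [← exp_log (show (0 : ℝ) < 2 ^ n by positivity), log_pow]
    exact exp_le_exp.2 (by nlinarith [n.cast_nonneg (α := ℝ)])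
  refine ⟨⌈2 * y⌉₊ + 1, ?_, ?_⟩
  · have h1 : 2 * t ≤ ((2 ^ (⌈2 * y⌉₊ + 1) : ℕ) : ℝ) := by
      push_cast
      rw [pow_succ, mul_comm]
      refine mul_le_mul_of_nonneg_right ?_ zero_le_two
      calc t ≤ exp y := hexp t
        _ ≤ exp ((⌈2 * y⌉₊ : ℝ) / 2) := exp_le_exp.2 (by linarith [Nat.le_ceil (2 * y)])
        _ ≤ _ := hpow _
    have h2 : R / ε ≤ 2 ^ 2 ^ (⌈2 * y⌉₊ + 1) := by
      calc R / ε ≤ exp t := hexp _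
        _ ≤ _ := exp_le_exp.2 (by linarith)
        _ ≤ _ := hpow _
    rwa [div_le_iff₀ hε, mul_comm] at h2
  · have := Nat.ceil_lt_add_one (show 0 ≤ 2 * y by positivity)
    push_cast
    linarith

theorem exists_pow_ge (d : ℝ) :
    ∃ N : ℕ, (d + 1) * 16 ≤ 2 ^ N ∧ (N : ℝ) ≤ 6 + 2 * log⁺ d := by
  have hy0 : 0 ≤ log⁺ d := posLog_nonneg
  have hln2 : 1 / 2 ≤ log 2 := by linarith [log_two_gt_d9]
  refine ⟨⌈2 * log⁺ d⌉₊ + 5, ?_, ?_⟩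
  · have h1 : exp (log⁺ d) ≤ 2 ^ ⌈2 * log⁺ d⌉₊ := by
      rw [← exp_log (show (0 : ℝ) < 2 ^ ⌈2 * log⁺ d⌉₊ by positivity), log_pow]
      exact exp_le_exp.2 (by nlinarith [Nat.le_ceil (2 * log⁺ d)])
    have h2 : d ≤ exp (log⁺ d) := by
      rcases le_or_gt d 0 with h | h
      · exact h.trans (exp_pos _).le
      · calc d = exp (log d) := (exp_log h).symm
          _ ≤ _ := exp_le_exp.2 (by rw [posLog_apply]; exact le_max_right _ _)
    have h3 : 1 ≤ exp (log⁺ d) := one_le_exp hy0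
    rw [pow_add]
    linarith
  · have := Nat.ceil_lt_add_one (show 0 ≤ 2 * log⁺ d by positivity)
    push_cast
    linarith

end RealRAM

theorem theorem2 :
    (∃ (P : RealRAM.Program) (C : ℝ), ∀ (k : ℕ) (f : ExpSum k) (R ε : ℝ),
      1 ≤ k → f.signAlternations ≤ 1 → 0 < R → 0 < ε →
      RealRAM.SolvesWithin P f R ε
        (C * (k * (1 + log⁺ f.degree + log⁺ (log⁺ (R / ε)))))) ∧
    (∃ (P : RealRAM.Program) (C : ℝ), P.OracleFree ∧ ∀ (k : ℕ) (f : ExpSum k) (R ε : ℝ),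
      1 ≤ k → f.IsNomial → f.signAlternations ≤ 1 → 0 < R → 0 < ε →
      RealRAM.SolvesWithin P f R ε
        (C * (k * (1 + log⁺ f.degree) *
          (1 + log⁺ f.degree + log⁺ (log⁺ (R / ε)))))) := by
  constructor
  · refine ⟨RealRAM.solver (.instr (.pow 14 5 13)), 1800, fun k f R ε hk hf hR hε => ?_⟩
    obtain ⟨N, hN, hN1⟩ := RealRAM.exists_pow_pow_ge (R := R) hε
    obtain ⟨N', hN', hN1'⟩ := RealRAM.exists_pow_ge f.degree
    obtain ⟨t, σ, h1, h2, h3⟩ := RealRAM.runs_solver hk hf hR hε RealRAM.computesPow_oracle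
      (fun _ _ _ => trivial) hN (fun i j => by linarith [f.sub_le_degree i j])
    refine ⟨t, σ, h1, h3, (Nat.cast_le.2 h2).trans ?_⟩
    push_cast
    have hd : 0 ≤ log⁺ f.degree := posLog_nonneg
    have hl : 0 ≤ log⁺ (log⁺ (R / ε)) := posLog_nonneg
    calc (k : ℝ) * 2 * (100 * (N + N' + 1)) = k * (200 * (N + N' + 1)) := by ring
      _ ≤ k * (1800 * (1 + log⁺ f.degree + log⁺ (log⁺ (R / ε)))) :=
          mul_le_mul_of_nonneg_left (by linarith) k.cast_nonneg
      _ = _ := by ring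
  · refine ⟨RealRAM.solver RealRAM.binaryPow, 57 * 900, ?_,
      fun k f R ε hk hint hf hR hε => ?_⟩
    · simp [RealRAM.solver, RealRAM.prepare, RealRAM.scanTop, RealRAM.scanSigns, RealRAM.locate,
        RealRAM.climb, RealRAM.descend, RealRAM.bisect, RealRAM.newtonLoop, RealRAM.evaluate,
        RealRAM.block, RealRAM.Program.OracleFree, RealRAM.binaryPow_oracleFree]
    obtain ⟨N, hN, hN1⟩ := RealRAM.exists_pow_pow_ge (R := R) hε
    obtain ⟨N', hN', hN1'⟩ := RealRAM.exists_pow_ge f.degree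
    have hsub : ∀ i j, (f.expo i - f.expo j + 1) * 16 ≤ 2 ^ N' := fun i j => by
      linarith [f.sub_le_degree i j]
    have hnat : ∀ i j, f.expo j ≤ f.expo i →
        ∃ n : ℕ, n < 2 ^ N' ∧ f.expo i - f.expo j = n := by
      intro i j hij
      obtain ⟨a, ha⟩ := hint i
      obtain ⟨b, hb⟩ := hint j
      have hab : b ≤ a := by rw [ha, hb] at hij; exact_mod_cast hij
      have hcast : ((a - b).toNat : ℝ) = f.expo i - f.expo j := by
        rw [ha, hb, ← Int.cast_natCast, Int.toNat_of_nonneg (by omega)]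
        push_cast
        ring
      refine ⟨(a - b).toNat, ?_, hcast.symm⟩
      have := hsub i j
      have hlt : ((a - b).toNat : ℝ) < 2 ^ N' := by
        rw [hcast]
        linarith [sub_nonneg.2 hij]
      exact_mod_cast hlt
    obtain ⟨t, σ, h1, h2, h3⟩ := RealRAM.runs_solver hk hf hR hε
      (RealRAM.computesPow_binaryPow N') hnat hN hsub
    refine ⟨t, σ, h1, h3, (Nat.cast_le.2 h2).trans ?_⟩
    push_cast
    have hd : 0 ≤ log⁺ f.degree := posLog_nonneg
    have hl : 0 ≤ log⁺ (log⁺ (R / ε)) := posLog_nonneg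
    calc (k : ℝ) * (8 * N' + 8 + 1) * (100 * (N + N' + 1))
        ≤ k * (57 * (1 + log⁺ f.degree)) *
          (900 * (1 + log⁺ f.degree + log⁺ (log⁺ (R / ε)))) :=
          mul_le_mul (mul_le_mul_of_nonneg_left (by linarith) k.cast_nonneg) (by linarith)
            (by positivity) (by positivity)
      _ = _ := by ring
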